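/- Let $|\rho|<1$ and let $(X_t)_{t\ge 0}$ be a strictly stationary process satisfying, almost surely, $X_t=\rho X_{t-1}+\sqrt{1-\rho^2}\,\varepsilon_t$ for every $t\ge 1$, where $\varepsilon_1,\varepsilon_2,\dots$ are independent standard normal random variables (the stationary Gaussian AR(1) process with unit variance). Let $f$ be the standard normal density, and for $k\ge 1$ put $$\nu_{2k}=(-1)^{k-1}\int_{-\infty}^{\infty}\ln|x|\,f^{(2k)}(x)\,dx .$$ Then these integrals converge absolutely and $\nu_{2k}=2^{k-1}(k-1)!$ for every $k\ge1$; each $\ln|X_t|$ is square-integrable with variance $\pi^2/8$; and the limiting variance $$\xi_\rho^2=\lim_{n\to\infty}\operatorname{Var}\Bigl(\frac1{\sqrt n}\sum_{t=1}^n\ln|X_t|\Bigr)$$ exists and equals the sum of a convergent Lambert series, $$\xi_\rho^2=\frac{\pi^2}{8}+2\sum_{k=1}^{\infty}\frac{\nu_{2k}^2}{(2k)!}\,\frac{\rho^{2k}}{1-\rho^{2k}} .$$ -/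

import Mathlib

open MeasureTheory ProbabilityTheory Filter Topology

/-- `X` is a (strictly) stationary Gaussian AR(1) process with parameter `ρ` and unit-variance
normalization: `X_t = ρ X_{t-1} + √(1 - ρ²) ε_t` for `t ≥ 1`, where the noise `ε_1, ε_2, …` is
independent and standard normal, and all time shifts of `X` have the same joint law
(`IdentDistrib` contains almost everywhere measurability). -/
structure IsStationaryAR1 {Ω : Type*} [MeasurableSpace Ω] (P : Measure Ω) (ρ : ℝ)
    (X : ℕ → Ω → ℝ) (ε : ℕ → Ω → ℝ) : Prop where
  noise_indep : iIndepFun (fun t : ℕ => ε (t + 1)) P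
  noise_law : ∀ t : ℕ, HasLaw (ε (t + 1)) (gaussianReal 0 1) P
  recursion : ∀ t : ℕ, ∀ᵐ ω ∂P, X (t + 1) ω = ρ * X t ω + √(1 - ρ ^ 2) * ε (t + 1) ω
  stationary : ∀ h : ℕ,
    IdentDistrib (fun ω (t : ℕ) => X (t + h) ω) (fun ω (t : ℕ) => X t ω) P P

/-- The coefficient `ν_{2k} = (-1)^{k-1} ∫ ln|x| f^{(2k)}(x) dx`, where `f` is the standard normal
density. The sign is written `(-1)^{k+1}` to avoid truncated subtraction. -/
noncomputable def logCoeff (k : ℕ) : ℝ :=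
  (-1) ^ (k + 1) * ∫ x : ℝ, Real.log |x| * iteratedDeriv (2 * k) (gaussianPDFReal 0 1) x

/-- The `k`-th term `ν_{2k}² / (2k)! · ρ^{2k} / (1 - ρ^{2k})` of the Lambert series. -/
noncomputable def lambertTerm (ρ : ℝ) (k : ℕ) : ℝ :=
  logCoeff k ^ 2 / ((2 * k).factorial : ℝ) * (ρ ^ (2 * k) / (1 - ρ ^ (2 * k)))

/-! Frullani's integral writes `log |x|` as `∫ (e^{-u} - e^{-u x²}) / (2u) du` over `u > 0`. The
covariance of `log |X|` and `log |Y|` is therefore a double integral of the joint Laplace transform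
of `(X², Y²)` minus the product of its marginals, divided by `4uv`. For standard normals of
correlation `r` this transform is `((1+2u)(1+2v) - 4uvr²)^{-1/2}`. With `p(u) = 2u/(1+2u)` the
binomial series in `p(u) p(v) r²` separates `u` from `v`, and Beta integrals give `∑ ν_{2k}² r^{2k}
/ (2k)!` (`hasSum_covariance_log_abs`).

At lag `h` the correlation is `ρ^h`. Summing the covariances over `h ≥ 1` turns `ρ^{2kh}` into
`ρ^{2k}/(1-ρ^{2k})`, and the normalized variance is a Cesàro mean converging to the variance plus
twice this sum.

Three further ingredients are needed. The reflection formula for Gamma gives the variance `π²/8`.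
Integration by parts against the Hermite recursion gives `ν_{2k}`. Stationarity identifies the law
of `(X_0, X_h)`: the share of `X_0` in `X_s` dies out, leaving Gaussian noise sums. -/

/-! ### Binomial series of `(1 - z)^{-1/2}`. -/

theorem multichoose_half (n : ℕ) :
    Ring.multichoose (1 / 2 : ℝ) n = (n.centralBinom : ℝ) / 4 ^ n := by
  have key : ∀ n : ℕ, ((n.factorial : ℕ) : ℝ) * Ring.multichoose (1 / 2 : ℝ) n
      = (ascPochhammer ℝ n).eval (1 / 2 : ℝ) := fun n => by
    rw [← nsmul_eq_mul, Ring.factorial_nsmul_multichoose_eq_ascPochhammer,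
      Polynomial.ascPochhammer_smeval_eq_eval]
  induction n with
  | zero => simp
  | succ n ih =>
    have h1 := key (n + 1)
    rw [ascPochhammer_succ_eval, ← key n, ih, Nat.factorial_succ] at h1
    have h2 : ((n : ℝ) + 1) * ((n + 1).centralBinom : ℝ) = 2 * (2 * n + 1) * n.centralBinom := by
      exact_mod_cast Nat.succ_mul_centralBinom_succ n
    have h3 : (n.factorial : ℝ) ≠ 0 := by positivity
    have h4 : (n : ℝ) + 1 ≠ 0 := by positivity
    apply mul_left_cancel₀ (mul_ne_zero h4 h3)
    push_cast at h1
    rw [h1, pow_succ]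
    field_simp
    linear_combination (-2 : ℝ) * h2

theorem hasSum_inv_sqrt_one_sub {z : ℝ} (hz : |z| < 1) :
    HasSum (fun k : ℕ => (k.centralBinom : ℝ) / 4 ^ k * z ^ k) ((√(1 - z))⁻¹) := by
  have h := (Real.one_div_one_sub_rpow_hasFPowerSeriesOnBall_zero (1 / 2)).hasSum
    (y := z) (by simpa [enorm_eq_nnnorm, ← NNReal.coe_lt_coe] using hz)
  simp only [zero_add, ← Real.sqrt_eq_rpow, one_div (√_), FormalMultilinearSeries.ofScalars_apply_eq,
    ← Ring.multichoose_eq, multichoose_half, smul_eq_mul] at h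
  exact h

/-! ### Beta integrals and the coefficients of `arcsin²`. -/

/-- The integrand `p ^ k (1 + 2u)^{-1/2} / u`, `p = 2u / (1 + 2u)`, with `k = j + 1`. -/
noncomputable def betaKernel (j : ℕ) (u : ℝ) : ℝ :=
  2 * (2 * u / (1 + 2 * u)) ^ j * ((1 + 2 * u)⁻¹ * (√(1 + 2 * u))⁻¹)

theorem betaKernel_nonneg (j : ℕ) {u : ℝ} (hu : 0 ≤ u) : 0 ≤ betaKernel j u := by
  unfold betaKernel; positivity

theorem betaKernel_le_zero (j : ℕ) {u : ℝ} (hu : 0 ≤ u) : betaKernel j u ≤ betaKernel 0 u := by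
  unfold betaKernel
  refine mul_le_mul_of_nonneg_right (mul_le_mul_of_nonneg_left ?_ two_pos.le) (by positivity)
  rw [pow_zero]
  exact pow_le_one₀ (by positivity) ((div_le_one (by positivity)).2 (by linarith))

theorem measurable_betaKernel (j : ℕ) : Measurable (betaKernel j) := by
  unfold betaKernel; fun_prop

theorem hasDerivAt_inv_sqrt_one_add {u : ℝ} (hu : 0 ≤ u) :
    HasDerivAt (fun u : ℝ => (√(1 + 2 * u))⁻¹) (-((1 + 2 * u)⁻¹ * (√(1 + 2 * u))⁻¹)) u := by
  have hp : 0 < 1 + 2 * u := by positivity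
  have h1 : HasDerivAt (fun u : ℝ => 1 + 2 * u) 2 u := by
    simpa using ((hasDerivAt_id u).const_mul 2).const_add 1
  convert! (h1.sqrt hp.ne').inv (Real.sqrt_pos.2 hp).ne' using 1
  rw [Real.sq_sqrt hp.le]
  field_simp

theorem tendsto_inv_sqrt_one_add : Tendsto (fun u : ℝ => (√(1 + 2 * u))⁻¹) atTop (𝓝 0) := by
  apply tendsto_inv_atTop_zero.comp
  apply Real.tendsto_sqrt_atTop.comp
  exact tendsto_atTop_add_const_left _ _ (tendsto_id.const_mul_atTop two_pos)

theorem integrableOn_betaKernel (j : ℕ) : IntegrableOn (betaKernel j) (Set.Ioi 0) := by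
  have h0 : IntegrableOn (betaKernel 0) (Set.Ioi 0) := by
    refine integrableOn_Ioi_deriv_of_nonneg' (g := fun u => -2 * (√(1 + 2 * u))⁻¹) (l := 0)
      (fun u hu => ?_) (fun u hu => betaKernel_nonneg 0 (le_of_lt hu)) ?_
    · convert! (hasDerivAt_inv_sqrt_one_add hu).const_mul (-2) using 1
      simp [betaKernel]
    · simpa using tendsto_inv_sqrt_one_add.const_mul (-2)
  refine h0.mono' (measurable_betaKernel j).aestronglyMeasurable ?_
  filter_upwards [ae_restrict_mem measurableSet_Ioi] with u hu
  rw [Real.norm_of_nonneg (betaKernel_nonneg j (le_of_lt hu))]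
  exact betaKernel_le_zero j (le_of_lt hu)

theorem integral_betaKernel_zero : ∫ u in Set.Ioi 0, betaKernel 0 u = 2 := by
  have := integral_Ioi_of_hasDerivAt_of_tendsto' (f := fun u => -2 * (√(1 + 2 * u))⁻¹)
    (f' := betaKernel 0) (a := 0) (m := 0) (fun u hu => ?_) (integrableOn_betaKernel 0) ?_
  · rw [this]; simp
  · convert! (hasDerivAt_inv_sqrt_one_add hu).const_mul (-2) using 1
    simp [betaKernel]
  · simpa using tendsto_inv_sqrt_one_add.const_mul (-2)

/-- The substitution `p = 2u/(1+2u)` turns the kernel into `p^j (1-p)^{-1/2} dp`. The recursion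
integrates the derivative of `p^{j+1} (1-p)^{1/2}`, which vanishes at both ends. -/
theorem integral_betaKernel_succ (j : ℕ) :
    ((j : ℝ) + 3 / 2) * ∫ u in Set.Ioi 0, betaKernel (j + 1) u =
      ((j : ℝ) + 1) * ∫ u in Set.Ioi 0, betaKernel j u := by
  have := integral_Ioi_of_hasDerivAt_of_tendsto'
    (f := fun u => (2 * u / (1 + 2 * u)) ^ (j + 1) * (√(1 + 2 * u))⁻¹)
    (f' := fun u => ((j : ℝ) + 1) * betaKernel j u - ((j : ℝ) + 3 / 2) * betaKernel (j + 1) u)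
    (a := 0) (m := 0) (fun u hu => ?_)
    (((integrableOn_betaKernel j).const_mul _).sub ((integrableOn_betaKernel (j + 1)).const_mul _))
    ?_
  · rw [integral_sub ((integrableOn_betaKernel j).const_mul _)
      ((integrableOn_betaKernel (j + 1)).const_mul _), integral_const_mul, integral_const_mul] at this
    simp at this
    linarith
  · have hu' : (0 : ℝ) ≤ u := hu
    have hp : 0 < 1 + 2 * u := by positivity
    have h1 : HasDerivAt (fun u : ℝ => 2 * u / (1 + 2 * u)) (2 / (1 + 2 * u) ^ 2) u := by
      have ha : HasDerivAt (fun u : ℝ => 2 * u) 2 u := by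
        simpa using ((hasDerivAt_id u).const_mul 2)
      convert! ha.div (ha.const_add 1) hp.ne' using 1
      ring
    convert! (h1.pow (j + 1)).mul (hasDerivAt_inv_sqrt_one_add hu') using 1
    have h2 : √(1 + 2 * u) ≠ 0 := (Real.sqrt_pos.2 hp).ne'
    simp only [betaKernel, Pi.pow_apply, pow_succ, Nat.add_sub_cancel]
    generalize (2 * u / (1 + 2 * u)) ^ j = q
    push_cast
    field_simp
    ring
  · refine squeeze_zero' (g := fun u => (√(1 + 2 * u))⁻¹) ?_ ?_ tendsto_inv_sqrt_one_add
    · filter_upwards [eventually_ge_atTop 0] with u hu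
      positivity
    · filter_upwards [eventually_ge_atTop 0] with u hu
      apply mul_le_of_le_one_left (by positivity)
      exact pow_le_one₀ (by positivity) ((div_le_one (by positivity)).2 (by linarith))

/-- `C(2k,k) 4^{-k} B(k,1/2) = 1/k` with `k = j + 1`. -/
theorem centralBinom_mul_integral_betaKernel (j : ℕ) :
    ((j + 1).centralBinom : ℝ) / 4 ^ (j + 1) * ∫ u in Set.Ioi 0, betaKernel j u
      = ((j : ℝ) + 1)⁻¹ := by
  induction j with
  | zero => rw [integral_betaKernel_zero]; norm_num [Nat.centralBinom_eq_two_mul_choose]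
  | succ j ih =>
    have h := integral_betaKernel_succ j
    have h2 : ((j : ℝ) + 2) * ((j + 2).centralBinom : ℝ)
        = 2 * (2 * (j + 1) + 1) * (j + 1).centralBinom := by
      have := Nat.succ_mul_centralBinom_succ (j + 1)
      exact_mod_cast this
    have h3 : (j : ℝ) + 2 ≠ 0 := by positivity
    have h4 : (j : ℝ) + 1 ≠ 0 := by positivity
    have h5 : (j : ℝ) + 3 / 2 ≠ 0 := by positivity
    generalize (∫ u in Set.Ioi 0, betaKernel (j + 1) u) = I' at *
    generalize (∫ u in Set.Ioi 0, betaKernel j u) = I at *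
    have hb : ((j + 2).centralBinom : ℝ) = 2 * (2 * (j + 1) + 1) * (j + 1).centralBinom / (j + 2) := by
      field_simp; linarith
    have hI : I' = (j + 1) * I / (j + 3 / 2) := by field_simp; linarith
    rw [show j + 1 + 1 = j + 2 from rfl, hb, hI]
    push_cast
    rw [pow_succ]
    have e : 2 * (2 * ((j : ℝ) + 1) + 1) * ((j + 1).centralBinom : ℝ) / (j + 2) / (4 ^ (j + 1) * 4)
        * ((j + 1) * I / (j + 3 / 2))
        = ((j + 1).centralBinom / 4 ^ (j + 1) * I) * ((j + 1) / (j + 2)) := by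
      field_simp
      ring
    rw [e, ih]
    field_simp
    ring

theorem integral_betaKernel (j : ℕ) :
    ∫ u in Set.Ioi 0, betaKernel j u
      = 4 ^ (j + 1) / (((j : ℝ) + 1) * ((j + 1).centralBinom : ℝ)) := by
  have h := centralBinom_mul_integral_betaKernel j
  have hc : ((j + 1).centralBinom : ℝ) ≠ 0 := by exact_mod_cast (Nat.centralBinom_ne_zero _)
  have h4 : (j : ℝ) + 1 ≠ 0 := by positivity
  field_simp at h ⊢
  linarith

/-- The coefficient `4^{k-1} ((k-1)!)² / (2k)!` with `k = j + 1`. -/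
noncomputable def arcsinSqCoeff (j : ℕ) : ℝ :=
  (2 ^ j * (j.factorial : ℝ)) ^ 2 / ((2 * (j + 1)).factorial : ℝ)

/-- The square comes from the separated integrals in `u` and `v`, the final `4` from the
denominators `2u` and `2v` of the two Frullani kernels. -/
theorem arcsinSqCoeff_eq (j : ℕ) :
    ((j + 1).centralBinom : ℝ) / 4 ^ (j + 1) * (∫ u in Set.Ioi 0, betaKernel j u) ^ 2 / 4
      = arcsinSqCoeff j := by
  rw [pow_two, ← mul_assoc, centralBinom_mul_integral_betaKernel, integral_betaKernel]
  have h : ((j + 1).centralBinom : ℝ) * ((j + 1).factorial * (j + 1).factorial)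
      = (2 * (j + 1)).factorial := by
    rw [← mul_assoc, Nat.centralBinom_eq_two_mul_choose]
    have := Nat.choose_mul_factorial_mul_factorial (n := 2 * (j + 1)) (k := j + 1) (by omega)
    rw [show 2 * (j + 1) - (j + 1) = j + 1 by omega] at this
    exact_mod_cast this
  have hc : ((j + 1).centralBinom : ℝ) ≠ 0 := by exact_mod_cast (Nat.centralBinom_ne_zero _)
  have hf : (j.factorial : ℝ) ≠ 0 := by positivity
  have h4 : (j : ℝ) + 1 ≠ 0 := by positivity
  rw [arcsinSqCoeff, ← h, Nat.factorial_succ, mul_pow, ← pow_mul, mul_comm j 2, pow_mul, pow_succ]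
  push_cast
  norm_num
  field_simp

theorem arcsinSqCoeff_nonneg (j : ℕ) : 0 ≤ arcsinSqCoeff j := by
  unfold arcsinSqCoeff; positivity

theorem arcsinSqCoeff_le_one (j : ℕ) : arcsinSqCoeff j ≤ 1 := by
  have hle : ∫ u in Set.Ioi 0, betaKernel j u ≤ 2 := by
    rw [← integral_betaKernel_zero]
    refine setIntegral_mono_on (integrableOn_betaKernel j) (integrableOn_betaKernel 0)
      measurableSet_Ioi (fun u hu => betaKernel_le_zero j (le_of_lt hu))
  have h0 : 0 ≤ ∫ u in Set.Ioi 0, betaKernel j u :=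
    setIntegral_nonneg measurableSet_Ioi (fun u hu => betaKernel_nonneg j (le_of_lt hu))
  rw [← arcsinSqCoeff_eq, pow_two, ← mul_assoc, centralBinom_mul_integral_betaKernel]
  have : ((j : ℝ) + 1)⁻¹ ≤ 1 := inv_le_one_of_one_le₀ (by linarith [j.cast_nonneg (α := ℝ)])
  nlinarith

/-! ### Exponential moments and variance of `log |Z|`. -/

theorem gaussianPDFReal_zero_one (x : ℝ) :
    gaussianPDFReal 0 1 x = (√(2 * Real.pi))⁻¹ * Real.exp (-(x ^ 2 / 2)) := by
  simp [gaussianPDFReal, neg_div]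

theorem ae_ne_zero_gaussianReal : ∀ᵐ x ∂(gaussianReal 0 1), x ≠ 0 := by
  have := nullSingletonClass_gaussianReal (μ := 0) (v := 1) one_ne_zero
  simp [ae_iff]

theorem mgf_log_abs_gaussianReal {t : ℝ} (ht : -1 < t) :
    mgf (fun x => Real.log |x|) (gaussianReal 0 1) t
      = 2 * (√(2 * Real.pi))⁻¹ * ((1 / 2) ^ (-(t + 1) / 2) * (1 / 2) * Real.Gamma ((t + 1) / 2)) := by
  have h1 : mgf (fun x => Real.log |x|) (gaussianReal 0 1) t
      = ∫ x, |x| ^ t ∂(gaussianReal 0 1) := by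
    refine integral_congr_ae ?_
    filter_upwards [ae_ne_zero_gaussianReal] with x hx
    rw [Real.rpow_def_of_pos (abs_pos.2 hx), mul_comm]
  rw [h1, integral_gaussianReal_eq_integral_smul one_ne_zero]
  have h2 : ∀ x : ℝ, gaussianPDFReal 0 1 x • |x| ^ t
      = (fun y : ℝ => (√(2 * Real.pi))⁻¹ * (y ^ t * Real.exp (-(1 / 2) * y ^ (2 : ℝ)))) |x| := by
    intro x
    simp only [smul_eq_mul, gaussianPDFReal_zero_one, Real.rpow_two, sq_abs]
    ring_nf
  simp_rw [h2]
  rw [integral_comp_abs (f := fun y : ℝ => (√(2 * Real.pi))⁻¹ *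
    (y ^ t * Real.exp (-(1 / 2) * y ^ (2 : ℝ)))), integral_const_mul,
    integral_rpow_mul_exp_neg_mul_rpow two_pos ht (by norm_num)]
  ring

theorem mgf_log_abs_gaussianReal_pos {t : ℝ} (ht : -1 < t) :
    0 < mgf (fun x => Real.log |x|) (gaussianReal 0 1) t := by
  rw [mgf_log_abs_gaussianReal ht]
  have : 0 < Real.Gamma ((t + 1) / 2) := Real.Gamma_pos_of_pos (by linarith)
  have := Real.pi_pos
  positivity

/-- Euler's reflection formula removes the Gamma factors. The even part of the cumulant generating
function suffices for its second derivative at `0`, so no digamma values are needed. -/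
theorem mgf_log_abs_gaussianReal_mul_neg {t : ℝ} (ht : |t| < 1) :
    mgf (fun x => Real.log |x|) (gaussianReal 0 1) t
      * mgf (fun x => Real.log |x|) (gaussianReal 0 1) (-t) = (Real.cos (Real.pi / 2 * t))⁻¹ := by
  obtain ⟨h1, h2⟩ := abs_lt.1 ht
  rw [mgf_log_abs_gaussianReal h1, mgf_log_abs_gaussianReal (by linarith)]
  have hG := Real.Gamma_mul_Gamma_one_sub ((t + 1) / 2)
  rw [show 1 - (t + 1) / 2 = (-t + 1) / 2 by ring,
    show Real.pi * ((t + 1) / 2) = Real.pi / 2 * t + Real.pi / 2 by ring, Real.sin_add_pi_div_two]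
    at hG
  have hp : ((1 / 2 : ℝ)) ^ (-(t + 1) / 2) * (1 / 2) ^ (-(-t + 1) / 2) = 2 := by
    rw [← Real.rpow_add (by norm_num), show -(t + 1) / 2 + -(-t + 1) / 2 = -1 by ring,
      Real.rpow_neg_one]
    norm_num
  have hs : (√(2 * Real.pi))⁻¹ * (√(2 * Real.pi))⁻¹ = (2 * Real.pi)⁻¹ := by
    rw [← mul_inv, Real.mul_self_sqrt (by positivity)]
  calc _ = ((√(2 * Real.pi))⁻¹ * (√(2 * Real.pi))⁻¹)
        * (((1 / 2 : ℝ)) ^ (-(t + 1) / 2) * (1 / 2) ^ (-(-t + 1) / 2))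
        * (Real.Gamma ((t + 1) / 2) * Real.Gamma ((-t + 1) / 2)) := by ring
    _ = _ := by
      rw [hs, hp, hG]
      field_simp

theorem zero_mem_interior_integrableExpSet_log_abs :
    0 ∈ interior (integrableExpSet (fun x => Real.log |x|) (gaussianReal 0 1)) := by
  rw [mem_interior_iff_mem_nhds]
  filter_upwards [Ioi_mem_nhds (show (-1 : ℝ) < 0 by norm_num)] with t ht
  by_contra h
  -- Without integrability the integral would take its default value `0`, but the Gamma formula is
  -- positive.
  exact (mgf_log_abs_gaussianReal_pos ht).ne' (integral_undef h)

theorem memLp_log_abs_gaussianReal : MemLp (fun x => Real.log |x|) 2 (gaussianReal 0 1) := by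
  exact_mod_cast memLp_of_mem_interior_integrableExpSet
    zero_mem_interior_integrableExpSet_log_abs 2

theorem iteratedDeriv_two_neg_log_cos :
    iteratedDeriv 2 (fun t => -Real.log (Real.cos (Real.pi / 2 * t))) 0 = Real.pi ^ 2 / 4 := by
  have hlin : ∀ t : ℝ, HasDerivAt (fun t : ℝ => Real.pi / 2 * t) (Real.pi / 2) t := fun t => by
    simpa using (hasDerivAt_id t).const_mul (Real.pi / 2)
  have h1 : deriv (fun t => -Real.log (Real.cos (Real.pi / 2 * t)))
      =ᶠ[𝓝 0] fun t => Real.pi / 2 * Real.tan (Real.pi / 2 * t) := by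
    have : ∀ᶠ t in 𝓝 (0 : ℝ), Real.cos (Real.pi / 2 * t) ≠ 0 :=
      ContinuousAt.eventually_ne (by fun_prop) (by simp)
    filter_upwards [this] with t ht
    refine (((hlin t).cos.log ht).neg).deriv.trans ?_
    rw [Real.tan_eq_sin_div_cos]
    ring
  rw [iteratedDeriv_succ, iteratedDeriv_one, h1.deriv_eq]
  have h2 : HasDerivAt Real.tan 1 (Real.pi / 2 * 0) := by
    simpa using Real.hasDerivAt_tan (x := Real.pi / 2 * 0) (by simp)
  refine ((h2.comp 0 (hlin 0)).const_mul (Real.pi / 2)).deriv.trans ?_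
  ring

theorem variance_log_abs_gaussianReal :
    variance (fun x => Real.log |x|) (gaussianReal 0 1) = Real.pi ^ 2 / 8 := by
  set Y : ℝ → ℝ := fun x => Real.log |x| with hY
  have h0 := zero_mem_interior_integrableExpSet_log_abs
  have hv : variance Y (gaussianReal 0 1) = iteratedDeriv 2 (cgf Y (gaussianReal 0 1)) 0 := by
    rw [iteratedDeriv_two_cgf h0, deriv_cgf_zero h0, variance_eq_sub memLp_log_abs_gaussianReal]
    simp
  have hc : ContDiffAt ℝ 2 (cgf Y (gaussianReal 0 1)) 0 := (analyticAt_cgf h0).contDiffAt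
  have hcn : ContDiffAt ℝ 2 (fun t => cgf Y (gaussianReal 0 1) (-t)) 0 :=
    ContDiffAt.comp (𝕜 := ℝ) (0 : ℝ) (g := cgf Y (gaussianReal 0 1)) (by simpa using hc)
      contDiff_neg.contDiffAt
  have he : (fun t => cgf Y (gaussianReal 0 1) t + cgf Y (gaussianReal 0 1) (-t))
      =ᶠ[𝓝 0] fun t => -Real.log (Real.cos (Real.pi / 2 * t)) := by
    filter_upwards [Ioo_mem_nhds (show (-1 : ℝ) < 0 by norm_num) one_pos] with t ht
    rw [cgf, cgf, ← Real.log_mul (mgf_log_abs_gaussianReal_pos ht.1).ne'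
      (mgf_log_abs_gaussianReal_pos (by linarith [ht.2])).ne',
      mgf_log_abs_gaussianReal_mul_neg (abs_lt.2 ht), Real.log_inv]
  have h2 := iteratedDeriv_two_neg_log_cos
  rw [← he.iteratedDeriv_eq 2, iteratedDeriv_fun_add hc hcn, iteratedDeriv_comp_neg] at h2
  rw [hv]
  simp at h2
  linarith

/-! ### Laplace transforms of Gaussian squares. -/

theorem integral_exp_neg_mul_sq_gaussianReal {v : ℝ} (hv : 0 ≤ v) (m : ℝ) (w : NNReal) :
    ∫ x, Real.exp (-(v * x ^ 2)) ∂(gaussianReal m w)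
      = (√(1 + 2 * v * w))⁻¹ * Real.exp (-(v * m ^ 2 / (1 + 2 * v * w))) := by
  -- The Dirac case is needed later: the empty noise sum has variance `0`.
  rcases eq_or_ne w 0 with rfl | hw
  · simp
  have hw' : (0 : ℝ) < w := by positivity
  have hp : 0 < 1 + 2 * v * w := by positivity
  rw [integral_gaussianReal_eq_integral_smul hw]
  have h : ∀ x : ℝ, gaussianPDFReal m w x • Real.exp (-(v * x ^ 2))
      = ((√(2 * Real.pi * w))⁻¹ * Real.exp (-(v * m ^ 2 / (1 + 2 * v * w)))) *
        (fun y => Real.exp (-((1 + 2 * v * w) / (2 * w)) * y ^ 2)) (x - m / (1 + 2 * v * w)) := by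
    intro x
    simp only [gaussianPDFReal, smul_eq_mul]
    rw [mul_assoc, mul_assoc (√(2 * Real.pi * w))⁻¹, ← Real.exp_add, ← Real.exp_add]
    congr 2
    field_simp
    ring
  simp_rw [h]
  rw [integral_const_mul, integral_sub_right_eq_self
    (fun y => Real.exp (-((1 + 2 * v * w) / (2 * w)) * y ^ 2)), integral_gaussian]
  have : Real.pi / ((1 + 2 * v * w) / (2 * w)) = (2 * Real.pi * w) / (1 + 2 * v * w) := by
    field_simp
  rw [this, Real.sqrt_div (by positivity)]
  have h1 : √(2 * Real.pi * w) ≠ 0 := by positivity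
  field_simp

theorem integrable_exp_neg {α : Type*} [MeasurableSpace α] {μ : Measure α} [IsFiniteMeasure μ]
    {g : α → ℝ} (hg : AEMeasurable g μ) (h0 : ∀ x, 0 ≤ g x) :
    Integrable (fun x => Real.exp (-g x)) μ := by
  refine Integrable.of_bound (C := 1) (by fun_prop) (ae_of_all _ fun x => ?_)
  rw [Real.norm_of_nonneg (Real.exp_pos _).le]
  exact Real.exp_le_one_iff.2 (by linarith [h0 x])

/-- The pair `(x, r x + y)` models a noise sum and its continuation `h` steps later, with `r = ρ^h`.
Integrating out `y` leaves a one-dimensional transform in `x`. -/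
theorem integral_exp_neg_quadratic_prod_gaussianReal {u v : ℝ} (hu : 0 ≤ u) (hv : 0 ≤ v) (r : ℝ)
    (a b : NNReal) :
    ∫ z, Real.exp (-(u * z.1 ^ 2 + v * (r * z.1 + z.2) ^ 2))
        ∂((gaussianReal 0 a).prod (gaussianReal 0 b))
      = (√((1 + 2 * u * a) * (1 + 2 * v * b) + 2 * a * v * r ^ 2))⁻¹ := by
  rw [integral_prod _ (integrable_exp_neg (by fun_prop) fun z => by positivity)]
  have hp : 0 < 1 + 2 * v * b := by positivity
  have h1 : ∀ x : ℝ, ∫ y, Real.exp (-(u * x ^ 2 + v * (r * x + y) ^ 2)) ∂(gaussianReal 0 b)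
      = (√(1 + 2 * v * b))⁻¹ * Real.exp (-((u + v * r ^ 2 / (1 + 2 * v * b)) * x ^ 2)) := by
    intro x
    have hm : (gaussianReal 0 b).map (fun y => r * x + y) = gaussianReal (r * x) b := by
      rw [gaussianReal_map_const_add]; simp
    have h2 := integral_exp_neg_mul_sq_gaussianReal hv (r * x) b
    rw [← hm, integral_map (by fun_prop) (by fun_prop)] at h2
    simp_rw [neg_add, Real.exp_add]
    rw [integral_const_mul, h2, add_mul, neg_add, Real.exp_add]
    ring_nf
  simp_rw [h1]
  rw [integral_const_mul, integral_exp_neg_mul_sq_gaussianReal (by positivity)]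
  have h3 : (1 + 2 * u * a) * (1 + 2 * v * b) + 2 * a * v * r ^ 2
      = (1 + 2 * v * b) * (1 + 2 * (u + v * r ^ 2 / (1 + 2 * v * b)) * a) := by
    field_simp
    ring
  rw [h3, Real.sqrt_mul hp.le]
  simp [mul_comm]

/-! ### Frullani representation of `log |x|`. -/

/-- The Frullani kernel of `log |x|`. -/
noncomputable def logKernel (u x : ℝ) : ℝ :=
  (Real.exp (-u) - Real.exp (-(u * x ^ 2))) / (2 * u)

theorem exp_neg_sub_exp_neg_le (a b : ℝ) :
    Real.exp (-a) - Real.exp (-b) ≤ (b - a) * Real.exp (-a) := by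
  have h : Real.exp (-b) = Real.exp (-a) * Real.exp (a - b) := by
    rw [← Real.exp_add]; ring_nf
  have := Real.add_one_le_exp (a - b)
  have := Real.exp_pos (-a)
  rw [h]
  nlinarith

/-- The tangent-line bound on the exponential, used in both directions, cancels the `1/u`. The
majorant is integrable on the half-line for `x ≠ 0`. -/
theorem abs_logKernel_le {u : ℝ} (hu : 0 < u) (x : ℝ) :
    |logKernel u x| ≤ |x ^ 2 - 1| * (Real.exp (-u) + Real.exp (-(x ^ 2 * u))) := by
  have h1 := exp_neg_sub_exp_neg_le u (u * x ^ 2)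
  have h2 := exp_neg_sub_exp_neg_le (u * x ^ 2) u
  have e1 := Real.exp_pos (-u)
  have e2 := Real.exp_pos (-(u * x ^ 2))
  rw [logKernel, abs_div, abs_of_pos (show 0 < 2 * u by positivity), div_le_iff₀ (by positivity),
    mul_comm (x ^ 2) u]
  have h3 : |x ^ 2 - 1| * (Real.exp (-u) + Real.exp (-(u * x ^ 2))) * (2 * u)
      = 2 * (|u * x ^ 2 - u| * (Real.exp (-u) + Real.exp (-(u * x ^ 2)))) := by
    rw [show u * x ^ 2 - u = u * (x ^ 2 - 1) by ring, abs_mul, abs_of_pos hu]; ring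
  rw [h3, abs_le]
  have h4 := le_abs_self (u * x ^ 2 - u)
  have h5 := neg_abs_le (u * x ^ 2 - u)
  constructor <;> nlinarith [abs_nonneg (u * x ^ 2 - u)]

theorem measurable_logKernel : Measurable (fun z : ℝ × ℝ => logKernel z.1 z.2) := by
  unfold logKernel; fun_prop

theorem integrableOn_logKernel {x : ℝ} (hx : x ≠ 0) :
    IntegrableOn (fun u => logKernel u x) (Set.Ioi 0) := by
  have hx2 : 0 < x ^ 2 := by positivity
  have hg : IntegrableOn (fun u => |x ^ 2 - 1| * (Real.exp (-u) + Real.exp (-(x ^ 2 * u))))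
      (Set.Ioi 0) := by
    refine Integrable.const_mul (Integrable.add ?_ ?_) _
    · simpa [IntegrableOn] using exp_neg_integrableOn_Ioi 0 one_pos
    · simpa [IntegrableOn, neg_mul] using exp_neg_integrableOn_Ioi 0 hx2
  refine Integrable.mono' hg ?_ ?_
  · exact (measurable_logKernel.comp (measurable_id.prodMk measurable_const)).aestronglyMeasurable
  · filter_upwards [ae_restrict_mem measurableSet_Ioi] with u hu
    exact abs_logKernel_le hu x

theorem integral_logKernel {x : ℝ} (hx : x ≠ 0) :
    ∫ u in Set.Ioi 0, logKernel u x = Real.log |x| := by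
  have hx2 : 0 < x ^ 2 := by positivity
  have he : ∀ u : ℝ, u⁻¹ • ((fun y => Real.exp (-y)) (1 * u) - (fun y => Real.exp (-y)) (x ^ 2 * u))
      = 2 * logKernel u x := by
    intro u
    simp only [logKernel, smul_eq_mul, one_mul, mul_comm (x ^ 2) u]
    rw [mul_div_assoc', mul_comm 2 u, mul_comm 2 (_ - _), mul_div_mul_right _ _ two_ne_zero]
    ring
  have h := Frullani.integral_Ioi_eq (f := fun y => Real.exp (-y)) (a := 1) (b := x ^ 2)
    (L := 1) (R := 0)
    ((by fun_prop : Continuous fun y : ℝ => Real.exp (-y)).locallyIntegrable.locallyIntegrableOn _)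
    one_pos hx2 ?_ ?_ ?_
  · simp_rw [he] at h
    rw [integral_const_mul] at h
    simp at h
    rw [Real.log_abs]
    linarith
  · have : Tendsto (fun y : ℝ => Real.exp (-y)) (𝓝 0) (𝓝 (Real.exp (-0))) :=
      (by fun_prop : Continuous fun y : ℝ => Real.exp (-y)).tendsto 0
    simpa using this.mono_left nhdsWithin_le_nhds
  · exact Real.tendsto_exp_neg_atTop_nhds_zero
  · simp_rw [he]
    exact (integrableOn_logKernel hx).const_mul 2

/-- The kernel keeps the sign of `x² - 1` for all `u > 0`, so nothing is lost by taking absolute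
values. -/
theorem integral_abs_logKernel {x : ℝ} (hx : x ≠ 0) :
    ∫ u in Set.Ioi 0, |logKernel u x| = |Real.log (|x|)| := by
  rcases le_total 1 (x ^ 2) with h | h
  · have h0 : ∀ u ∈ Set.Ioi (0 : ℝ), 0 ≤ logKernel u x := fun u (hu : 0 < u) =>
      div_nonneg (sub_nonneg.2 (Real.exp_le_exp.2 (by nlinarith))) (by positivity)
    rw [setIntegral_congr_fun measurableSet_Ioi (fun u hu => abs_of_nonneg (h0 u hu)),
      ← integral_logKernel hx, abs_of_nonneg (setIntegral_nonneg measurableSet_Ioi h0)]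
  · have h0 : ∀ u ∈ Set.Ioi (0 : ℝ), logKernel u x ≤ 0 := fun u (hu : 0 < u) =>
      div_nonpos_of_nonpos_of_nonneg
        (sub_nonpos.2 (Real.exp_le_exp.2 (by nlinarith))) (by positivity)
    rw [setIntegral_congr_fun measurableSet_Ioi (fun u hu => abs_of_nonpos (h0 u hu)),
      integral_neg, ← integral_logKernel hx, abs_of_nonpos (setIntegral_nonpos measurableSet_Ioi h0)]

/-! ### Covariance of the logarithms as a power series in the correlation. -/

theorem measurable_log_abs : Measurable (fun x : ℝ => Real.log |x|) :=
  Real.measurable_log.comp measurable_abs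

theorem memLp_log_abs_of_map {Ω : Type*} [MeasurableSpace Ω] {μ : Measure Ω} {U : Ω → ℝ}
    (h : μ.map U = gaussianReal 0 1) : MemLp (fun x => Real.log |U x|) 2 μ := by
  have hU : AEMeasurable U μ := AEMeasurable.of_map_ne_zero (by rw [h]; exact NeZero.ne _)
  have := memLp_log_abs_gaussianReal
  rw [← h, memLp_map_measure_iff measurable_log_abs.aestronglyMeasurable hU] at this
  exact this

theorem ae_ne_zero_prod {μ : Measure (ℝ × ℝ)}
    (h1 : μ.map Prod.fst = gaussianReal 0 1) (h2 : μ.map Prod.snd = gaussianReal 0 1) :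
    ∀ᵐ x ∂μ, x.1 ≠ 0 ∧ x.2 ≠ 0 := by
  have a1 := ae_ne_zero_gaussianReal
  have a2 := ae_ne_zero_gaussianReal
  rw [← h1] at a1
  rw [← h2] at a2
  filter_upwards [ae_of_ae_map (by fun_prop) a1, ae_of_ae_map (by fun_prop) a2] with x hx hy
  exact ⟨hx, hy⟩

/-- Integrating the absolute value over `(u, v)` gives `|log |x|| |log |y||`, a product of two
square-integrable functions. This justifies Fubini. -/
theorem integrable_prod_logKernel {μ : Measure (ℝ × ℝ)} [IsProbabilityMeasure μ]
    (h1 : μ.map Prod.fst = gaussianReal 0 1) (h2 : μ.map Prod.snd = gaussianReal 0 1) :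
    Integrable (fun z : (ℝ × ℝ) × (ℝ × ℝ) => logKernel z.2.1 z.1.1 * logKernel z.2.2 z.1.2)
      (μ.prod ((volume.restrict (Set.Ioi 0)).prod (volume.restrict (Set.Ioi 0)))) := by
  have hm : Measurable (fun z : (ℝ × ℝ) × (ℝ × ℝ) => logKernel z.2.1 z.1.1 * logKernel z.2.2 z.1.2) :=
    (measurable_logKernel.comp (by fun_prop : Measurable fun z : (ℝ × ℝ) × (ℝ × ℝ) =>
      (z.2.1, z.1.1))).mul (measurable_logKernel.comp
        (by fun_prop : Measurable fun z : (ℝ × ℝ) × (ℝ × ℝ) => (z.2.2, z.1.2)))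
  rw [integrable_prod_iff hm.aestronglyMeasurable]
  constructor
  · filter_upwards [ae_ne_zero_prod h1 h2] with x hx
    exact Integrable.mul_prod (integrableOn_logKernel hx.1) (integrableOn_logKernel hx.2)
  · have hL1 := memLp_log_abs_of_map h1
    have hL2 := memLp_log_abs_of_map h2
    refine (MemLp.integrable_mul hL1.norm hL2.norm).congr ?_
    filter_upwards [ae_ne_zero_prod h1 h2] with x hx
    simp only [norm_mul, Real.norm_eq_abs, Pi.mul_apply]
    rw [integral_prod_mul (fun u => |logKernel u x.1|) (fun v => |logKernel v x.2|),
      integral_abs_logKernel hx.1, integral_abs_logKernel hx.2]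

theorem integral_log_abs_mul_log_abs {μ : Measure (ℝ × ℝ)} [IsProbabilityMeasure μ]
    (h1 : μ.map Prod.fst = gaussianReal 0 1) (h2 : μ.map Prod.snd = gaussianReal 0 1) :
    ∫ x, Real.log |x.1| * Real.log |x.2| ∂μ
      = ∫ w, ∫ x, logKernel w.1 x.1 * logKernel w.2 x.2 ∂μ
          ∂((volume.restrict (Set.Ioi 0)).prod (volume.restrict (Set.Ioi 0))) := by
  rw [← integral_integral_swap (integrable_prod_logKernel h1 h2)]
  refine integral_congr_ae ?_
  filter_upwards [ae_ne_zero_prod h1 h2] with x hx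
  rw [integral_prod_mul (fun u => logKernel u x.1) (fun v => logKernel v x.2),
    integral_logKernel hx.1, integral_logKernel hx.2]

/-- All terms but the last depend only on the marginals, hence cancel when an independent pair is
subtracted. -/
theorem integral_logKernel_mul_logKernel {μ : Measure (ℝ × ℝ)} [IsProbabilityMeasure μ]
    (h1 : μ.map Prod.fst = gaussianReal 0 1) (h2 : μ.map Prod.snd = gaussianReal 0 1)
    {u v : ℝ} (hu : 0 < u) (hv : 0 < v) :
    ∫ x, logKernel u x.1 * logKernel v x.2 ∂μ
      = (Real.exp (-u) * Real.exp (-v) - Real.exp (-u) * (√(1 + 2 * v))⁻¹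
          - Real.exp (-v) * (√(1 + 2 * u))⁻¹
          + ∫ x, Real.exp (-(u * x.1 ^ 2 + v * x.2 ^ 2)) ∂μ) / (4 * u * v) := by
  have g1 : ∫ x, Real.exp (-(u * x.1 ^ 2)) ∂μ = (√(1 + 2 * u))⁻¹ := by
    have := integral_exp_neg_mul_sq_gaussianReal hu.le 0 1
    rw [← h1, integral_map (by fun_prop) (by fun_prop)] at this
    simpa using this
  have g2 : ∫ x, Real.exp (-(v * x.2 ^ 2)) ∂μ = (√(1 + 2 * v))⁻¹ := by
    have := integral_exp_neg_mul_sq_gaussianReal hv.le 0 1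
    rw [← h2, integral_map (by fun_prop) (by fun_prop)] at this
    simpa using this
  have i1 : Integrable (fun x : ℝ × ℝ => Real.exp (-(u * x.1 ^ 2))) μ :=
    integrable_exp_neg (by fun_prop) fun x => by positivity
  have i2 : Integrable (fun x : ℝ × ℝ => Real.exp (-(v * x.2 ^ 2))) μ :=
    integrable_exp_neg (by fun_prop) fun x => by positivity
  have i3 : Integrable (fun x : ℝ × ℝ => Real.exp (-(u * x.1 ^ 2 + v * x.2 ^ 2))) μ :=
    integrable_exp_neg (by fun_prop) fun x => by positivity
  have he : ∀ x : ℝ × ℝ, logKernel u x.1 * logKernel v x.2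
      = (Real.exp (-u) * Real.exp (-v) - Real.exp (-u) * Real.exp (-(v * x.2 ^ 2))
          - Real.exp (-v) * Real.exp (-(u * x.1 ^ 2))
          + Real.exp (-(u * x.1 ^ 2 + v * x.2 ^ 2))) / (4 * u * v) := by
    intro x
    rw [neg_add (u * x.1 ^ 2), Real.exp_add (-(u * x.1 ^ 2)), logKernel, logKernel]
    field_simp
    ring
  simp_rw [he]
  have j2 := i2.const_mul (Real.exp (-u))
  have j1 := i1.const_mul (Real.exp (-v))
  have j0 : Integrable (fun _ : ℝ × ℝ => Real.exp (-u) * Real.exp (-v)) μ := integrable_const _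
  rw [integral_div, integral_add ?_ i3, integral_sub ?_ j1, integral_sub j0 j2,
    integral_const_mul, integral_const_mul, integral_const_mul,
    g1, g2]
  · simp
  · exact j0.sub j2
  · exact (j0.sub j2).sub j1

theorem hasSum_betaKernel_mul_betaKernel {r : ℝ} (hr : |r| < 1) {u v : ℝ} (hu : 0 < u)
    (hv : 0 < v) :
    HasSum (fun j : ℕ => ((j + 1).centralBinom : ℝ) / 4 ^ (j + 1) / 4 * r ^ (2 * (j + 1)) *
        (betaKernel j u * betaKernel j v))
      (((√((1 + 2 * u) * (1 + 2 * v) - 4 * u * v * r ^ 2))⁻¹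
        - (√((1 + 2 * u) * (1 + 2 * v)))⁻¹) / (4 * u * v)) := by
  have hpu : 0 < 1 + 2 * u := by positivity
  have hpv : 0 < 1 + 2 * v := by positivity
  have hr2 : r ^ 2 < 1 := (sq_lt_one_iff_abs_lt_one r).2 hr
  set z := (2 * u / (1 + 2 * u)) * (2 * v / (1 + 2 * v)) * r ^ 2 with hz
  have hz0 : 0 ≤ z := by positivity
  have hz1 : z < 1 := by
    have ha : 2 * u / (1 + 2 * u) ≤ 1 := (div_le_one hpu).2 (by linarith)
    have hb : 2 * v / (1 + 2 * v) ≤ 1 := (div_le_one hpv).2 (by linarith)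
    calc z ≤ 1 * 1 * r ^ 2 := by rw [hz]; gcongr
      _ < 1 := by linarith
  have h := hasSum_inv_sqrt_one_sub (z := z) (by rwa [abs_of_nonneg hz0])
  -- The term of index `0` is the transform of an independent pair; it is moved to the other side.
  rw [← hasSum_nat_add_iff' 1] at h
  have hfac : (1 + 2 * u) * (1 + 2 * v) - 4 * u * v * r ^ 2
      = ((1 + 2 * u) * (1 + 2 * v)) * (1 - z) := by
    rw [hz]; field_simp; ring
  have h' := (h.mul_left ((√((1 + 2 * u) * (1 + 2 * v)))⁻¹)).div_const (4 * u * v)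
  convert! h' using 1
  · ext j
    rw [hz, mul_pow, mul_pow, ← pow_mul, Real.sqrt_mul hpu.le]
    simp only [betaKernel]
    rw [pow_succ (2 * u / (1 + 2 * u)), pow_succ (2 * v / (1 + 2 * v))]
    generalize (2 * u / (1 + 2 * u)) ^ j = q
    generalize (2 * v / (1 + 2 * v)) ^ j = q'
    have : √(1 + 2 * u) ≠ 0 := by positivity
    have : √(1 + 2 * v) ≠ 0 := by positivity
    field_simp
  · rw [hfac, Real.sqrt_mul (by positivity)]
    simp [mul_sub, mul_comm]

theorem map_fst_gaussian_prod : ((gaussianReal 0 1).prod (gaussianReal 0 1)).map Prod.fst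
    = gaussianReal 0 1 := by simp

theorem map_snd_gaussian_prod : ((gaussianReal 0 1).prod (gaussianReal 0 1)).map Prod.snd
    = gaussianReal 0 1 := by simp

/-- For standard normal variables with the joint Laplace transform of the squares of a Gaussian
pair of correlation `r`, the covariance of the logarithms is `arcsin² r / 2`, as a power series. -/
theorem hasSum_covariance_log_abs {μ : Measure (ℝ × ℝ)} [IsProbabilityMeasure μ]
    (h1 : μ.map Prod.fst = gaussianReal 0 1) (h2 : μ.map Prod.snd = gaussianReal 0 1)
    {r : ℝ} (hr : |r| < 1)
    (hL : ∀ u v : ℝ, 0 < u → 0 < v → ∫ x, Real.exp (-(u * x.1 ^ 2 + v * x.2 ^ 2)) ∂μ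
      = (√((1 + 2 * u) * (1 + 2 * v) - 4 * u * v * r ^ 2))⁻¹) :
    HasSum (fun j : ℕ => arcsinSqCoeff j * r ^ (2 * (j + 1)))
      (covariance (fun x => Real.log |x.1|) (fun x => Real.log |x.2|) μ) := by
  set L : Measure (ℝ × ℝ) := (volume.restrict (Set.Ioi 0)).prod (volume.restrict (Set.Ioi 0))
    with hLdef
  set γ := (gaussianReal 0 1).prod (gaussianReal 0 1) with hγ
  have hLpos : ∀ᵐ w ∂L, 0 < w.1 ∧ 0 < w.2 := by
    rw [hLdef, Measure.prod_restrict]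
    filter_upwards [ae_restrict_mem (measurableSet_Ioi.prod measurableSet_Ioi)] with w hw
    exact hw
  have e1 : ∫ x, Real.log |x.1| ∂μ = ∫ x, Real.log |x| ∂(gaussianReal 0 1) := by
    rw [← h1, integral_map (by fun_prop) measurable_log_abs.aestronglyMeasurable]
  have e2 : ∫ x, Real.log |x.2| ∂μ = ∫ x, Real.log |x| ∂(gaussianReal 0 1) := by
    rw [← h2, integral_map (by fun_prop) measurable_log_abs.aestronglyMeasurable]
  -- The product of the means is written as an integral over an independent pair, so that it too has
  -- a Frullani representation.
  have hcov : covariance (fun x => Real.log |x.1|) (fun x => Real.log |x.2|) μ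
      = ∫ x, Real.log |x.1| * Real.log |x.2| ∂μ - ∫ x, Real.log |x.1| * Real.log |x.2| ∂γ := by
    rw [covariance_eq_sub (memLp_log_abs_of_map h1) (memLp_log_abs_of_map h2), e1, e2, hγ,
      integral_prod_mul (fun x => Real.log |x|) (fun x => Real.log |x|)]
    rfl
  have hLγ : ∀ u v : ℝ, 0 < u → 0 < v → ∫ x, Real.exp (-(u * x.1 ^ 2 + v * x.2 ^ 2)) ∂γ
      = (√((1 + 2 * u) * (1 + 2 * v)))⁻¹ := by
    intro u v hu hv
    simpa using integral_exp_neg_quadratic_prod_gaussianReal hu.le hv.le 0 1 1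
  rw [hcov, integral_log_abs_mul_log_abs h1 h2,
    integral_log_abs_mul_log_abs map_fst_gaussian_prod map_snd_gaussian_prod,
    ← integral_sub (integrable_prod_logKernel h1 h2).integral_prod_right
      (integrable_prod_logKernel map_fst_gaussian_prod map_snd_gaussian_prod).integral_prod_right]
  set F : ℕ → ℝ × ℝ → ℝ := fun j w => ((j + 1).centralBinom : ℝ) / 4 ^ (j + 1) / 4 *
    r ^ (2 * (j + 1)) * (betaKernel j w.1 * betaKernel j w.2) with hF
  have hint : ∀ j, Integrable (F j) L := fun j =>
    (Integrable.mul_prod (integrableOn_betaKernel j) (integrableOn_betaKernel j)).const_mul _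
  have hval : ∀ j, ∫ w, F j w ∂L = arcsinSqCoeff j * r ^ (2 * (j + 1)) := by
    intro j
    rw [hF]
    simp only
    rw [integral_const_mul, integral_prod_mul, ← arcsinSqCoeff_eq]
    ring
  have hnorm : ∀ j, ∫ w, ‖F j w‖ ∂L = arcsinSqCoeff j * r ^ (2 * (j + 1)) := by
    intro j
    rw [← hval j]
    refine integral_congr_ae ?_
    filter_upwards [hLpos] with w hw
    rw [Real.norm_of_nonneg]
    have := betaKernel_nonneg j hw.1.le
    have := betaKernel_nonneg j hw.2.le
    have : 0 ≤ r ^ (2 * (j + 1)) := by rw [pow_mul]; positivity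
    simp only [hF]
    positivity
  -- Since the terms are nonnegative, the norms sum to the series itself, dominated by a geometric
  -- series in `r²`. This permits termwise integration.
  have hsum : Summable fun j => ∫ w, ‖F j w‖ ∂L := by
    simp_rw [hnorm]
    have hr2 : r ^ 2 < 1 := (sq_lt_one_iff_abs_lt_one r).2 hr
    refine Summable.of_nonneg_of_le (fun j => ?_) (fun j => ?_)
      ((summable_nat_add_iff 1).2 (summable_geometric_of_lt_one (sq_nonneg r) hr2))
    · rw [pow_mul]; exact mul_nonneg (arcsinSqCoeff_nonneg j) (by positivity)
    · rw [pow_mul]; exact mul_le_of_le_one_left (by positivity) (arcsinSqCoeff_le_one j)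
  have hmain := hasSum_integral_of_summable_integral_norm hint hsum
  simp_rw [hval] at hmain
  convert! hmain using 1
  refine integral_congr_ae ?_
  filter_upwards [hLpos] with w hw
  rw [integral_logKernel_mul_logKernel h1 h2 hw.1 hw.2,
    integral_logKernel_mul_logKernel map_fst_gaussian_prod map_snd_gaussian_prod hw.1 hw.2,
    hL _ _ hw.1 hw.2, hLγ _ _ hw.1 hw.2, ← sub_div,
    (hasSum_betaKernel_mul_betaKernel hr hw.1 hw.2).tsum_eq]
  congr 1
  ring

/-! ### Gaussian laws of the stationary process. -/

/-- The part of `X (s + h)` contributed by the noise at the times `s + 1, …, s + h`. -/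
noncomputable def noiseSum {Ω : Type*} (ρ : ℝ) (ε : ℕ → Ω → ℝ) (s h : ℕ) (ω : Ω) : ℝ :=
  ∑ j ∈ Finset.Ico s (s + h), ρ ^ (s + h - 1 - j) * (√(1 - ρ ^ 2) * ε (j + 1) ω)

section
variable {Ω : Type*} {ρ : ℝ} {ε : ℕ → Ω → ℝ}

theorem noiseSum_zero (s : ℕ) (ω : Ω) : noiseSum ρ ε s 0 ω = 0 := by simp [noiseSum]

theorem noiseSum_one (s : ℕ) (ω : Ω) :
    noiseSum ρ ε s 1 ω = √(1 - ρ ^ 2) * ε (s + 1) ω := by simp [noiseSum]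

theorem noiseSum_succ (s h : ℕ) (ω : Ω) :
    noiseSum ρ ε s (h + 1) ω = ρ * noiseSum ρ ε s h ω + noiseSum ρ ε (s + h) 1 ω := by
  rw [noiseSum_one, noiseSum, ← add_assoc, Finset.sum_Ico_succ_top (by omega), noiseSum,
    Finset.mul_sum]
  congr 1
  · refine Finset.sum_congr rfl fun j hj => ?_
    have := Finset.mem_Ico.1 hj
    rw [show s + h + 1 - 1 - j = (s + h - 1 - j) + 1 by omega, pow_succ]
    ring
  · simp

end

section
variable {Ω : Type*} [MeasurableSpace Ω] {P : Measure Ω}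
  {ρ : ℝ} {X ε : ℕ → Ω → ℝ}

theorem IsStationaryAR1.aemeasurable_noiseSum (hX : IsStationaryAR1 P ρ X ε) (s h : ℕ) :
    AEMeasurable (noiseSum ρ ε s h) P := by
  have hm := fun t => (hX.noise_law t).aemeasurable
  unfold noiseSum
  exact Finset.aemeasurable_fun_sum _ fun j _ => ((hm j).const_mul _).const_mul _

theorem IsStationaryAR1.ae_eq_add_noiseSum (hX : IsStationaryAR1 P ρ X ε) (s h : ℕ) :
    ∀ᵐ ω ∂P, X (s + h) ω = ρ ^ h * X s ω + noiseSum ρ ε s h ω := by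
  induction h with
  | zero => simp [noiseSum_zero]
  | succ h ih =>
    filter_upwards [ih, hX.recursion (s + h)] with ω h1 h2
    rw [← add_assoc, h2, h1, noiseSum_succ, noiseSum_one]
    ring

theorem IsStationaryAR1.aemeasurable (hX : IsStationaryAR1 P ρ X ε) (t : ℕ) :
    AEMeasurable (X t) P :=
  (measurable_pi_apply t).comp_aemeasurable (hX.stationary 0).aemeasurable_snd

theorem IsStationaryAR1.identDistrib_pair (hX : IsStationaryAR1 P ρ X ε) (s h : ℕ) :
    IdentDistrib (fun ω => (X s ω, X (s + h) ω)) (fun ω => (X 0 ω, X h ω)) P P := by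
  have := (hX.stationary s).comp (u := fun x : ℕ → ℝ => (x 0, x h)) (by fun_prop)
  simpa [Function.comp_def, add_comm] using this

theorem IsStationaryAR1.indepFun_noiseSum (hX : IsStationaryAR1 P ρ X ε) {s h s' h' : ℕ}
    (hs : s + h ≤ s') : IndepFun (noiseSum ρ ε s h) (noiseSum ρ ε s' h') P := by
  have hd : Disjoint (Finset.Ico s (s + h)) (Finset.Ico s' (s' + h')) :=
    Finset.disjoint_left.2 fun j h1 h2 => by simp only [Finset.mem_Ico] at h1 h2; omega
  have hind := hX.noise_indep.indepFun_finset₀ _ _ hd fun t => (hX.noise_law t).aemeasurable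
  have hsum : ∀ a b : ℕ, noiseSum ρ ε a b
      = (fun x : Finset.Ico a (a + b) → ℝ =>
          ∑ j : Finset.Ico a (a + b), ρ ^ (a + b - 1 - j) * (√(1 - ρ ^ 2) * x j)) ∘
        (fun ω (j : Finset.Ico a (a + b)) => ε (j + 1) ω) := by
    intro a b
    ext ω
    exact (Finset.sum_coe_sort (Finset.Ico a (a + b))
      (fun j => ρ ^ (a + b - 1 - j) * (√(1 - ρ ^ 2) * ε (j + 1) ω))).symm
  rw [hsum s h, hsum s' h']
  exact hind.comp (by fun_prop) (by fun_prop)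

variable [IsProbabilityMeasure P]

/-- One more step is an independent Gaussian sum, with variance `ρ²(1 - ρ^{2h}) + (1 - ρ²) = 1 -
ρ^{2(h+1)}`. -/
theorem IsStationaryAR1.map_noiseSum (hX : IsStationaryAR1 P ρ X ε) (hρ : |ρ| < 1) (s h : ℕ) :
    P.map (noiseSum ρ ε s h) = gaussianReal 0 (Real.toNNReal (1 - ρ ^ (2 * h))) := by
  have hρ2 : ρ ^ 2 < 1 := (sq_lt_one_iff_abs_lt_one ρ).2 hρ
  induction h with
  | zero =>
    have : noiseSum ρ ε s 0 = fun _ => 0 := by ext ω; exact noiseSum_zero s ω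
    simp [this]
  | succ h ih =>
    have e : noiseSum ρ ε s (h + 1)
        = (fun ω => ρ * noiseSum ρ ε s h ω) + noiseSum ρ ε (s + h) 1 := by
      ext ω; exact noiseSum_succ s h ω
    have h1 : HasLaw (noiseSum ρ ε s h) (gaussianReal 0 (Real.toNNReal (1 - ρ ^ (2 * h)))) P :=
      ⟨hX.aemeasurable_noiseSum s h, ih⟩
    have h2 := gaussianReal_const_mul (hX.noise_law (s + h)) √(1 - ρ ^ 2)
    have h1' := gaussianReal_const_mul h1 ρ
    have e2 : (fun ω => √(1 - ρ ^ 2) * ε (s + h + 1) ω) = noiseSum ρ ε (s + h) 1 := by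
      ext ω; rw [noiseSum_one]
    rw [e2] at h2
    have hind : IndepFun (fun ω => ρ * noiseSum ρ ε s h ω) (noiseSum ρ ε (s + h) 1) P :=
      (hX.indepFun_noiseSum le_rfl).comp (φ := fun x => ρ * x) (ψ := id) (by fun_prop) measurable_id
    rw [e, gaussianReal_add_gaussianReal_of_indepFun hind h1'.map_eq h2.map_eq]
    have hp : ρ ^ (2 * h) ≤ 1 := by rw [pow_mul]; exact pow_le_one₀ (sq_nonneg _) hρ2.le
    have hp' : ρ ^ (2 * (h + 1)) ≤ 1 := by rw [pow_mul]; exact pow_le_one₀ (sq_nonneg _) hρ2.le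
    congr 1
    · simp
    · ext
      simp only [NNReal.coe_add, NNReal.coe_mul, NNReal.coe_mk, NNReal.coe_one]
      rw [Real.coe_toNNReal _ (by linarith), Real.coe_toNNReal _ (by linarith),
        Real.sq_sqrt (by linarith)]
      ring

/-- The stationary law is the limit of the laws obtained by dropping the initial value. -/
theorem IsStationaryAR1.tendsto_integral_noiseSum (hX : IsStationaryAR1 P ρ X ε) (hρ : |ρ| < 1)
    {E : Type*} [NormedAddCommGroup E] [NormedSpace ℝ E] [CompleteSpace E]
    [SecondCountableTopology E] {φ : ℝ × ℝ → E}
    (hφ : UniformContinuous φ) {C : ℝ} (hC : ∀ z, ‖φ z‖ ≤ C) (h : ℕ) :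
    Tendsto (fun s : ℕ => ∫ ω, φ (noiseSum ρ ε 0 s ω,
        ρ ^ h * noiseSum ρ ε 0 s ω + noiseSum ρ ε s h ω) ∂P) atTop
      (𝓝 (∫ ω, φ (X 0 ω, X h ω) ∂P)) := by
  have hcont := hφ.continuous
  have hm := hX.aemeasurable
  have hn := hX.aemeasurable_noiseSum
  have hXi : ∀ s, Integrable (fun ω => φ (X s ω, X (s + h) ω)) P := fun s =>
    Integrable.of_bound (hcont.comp_aestronglyMeasurable
      ((hm s).prodMk (hm (s + h))).aestronglyMeasurable) C (ae_of_all _ fun ω => hC _)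
  have hNm : ∀ s, AEMeasurable (fun ω => (noiseSum ρ ε 0 s ω,
      ρ ^ h * noiseSum ρ ε 0 s ω + noiseSum ρ ε s h ω)) P := fun s =>
    (hn 0 s).prodMk (((hn 0 s).const_mul _).add (hn s h))
  have hNi : ∀ s, Integrable (fun ω => φ (noiseSum ρ ε 0 s ω,
      ρ ^ h * noiseSum ρ ε 0 s ω + noiseSum ρ ε s h ω)) P := fun s =>
    Integrable.of_bound (hcont.comp_aestronglyMeasurable (hNm s).aestronglyMeasurable) C
      (ae_of_all _ fun ω => hC _)
  have hst : ∀ s, ∫ ω, φ (X s ω, X (s + h) ω) ∂P = ∫ ω, φ (X 0 ω, X h ω) ∂P := by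
    intro s
    have hid := hX.identDistrib_pair s h
    have h1 := integral_map (μ := P) hid.aemeasurable_fst (f := φ) hcont.aestronglyMeasurable
    have h2 := integral_map (μ := P) hid.aemeasurable_snd (f := φ) hcont.aestronglyMeasurable
    rw [← h1, ← h2, hid.map_eq]
  -- Both arguments of `φ` move with `s`, and only their distance is known to vanish; hence uniform
  -- rather than plain continuity.
  have hdiff : Tendsto (fun s : ℕ => ∫ ω, (φ (noiseSum ρ ε 0 s ω,
      ρ ^ h * noiseSum ρ ε 0 s ω + noiseSum ρ ε s h ω) - φ (X s ω, X (s + h) ω)) ∂P) atTop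
      (𝓝 (∫ _, (0 : E) ∂P)) := by
    refine tendsto_integral_of_dominated_convergence (fun _ => C + C)
      (fun s => ((hNi s).sub (hXi s)).1) (integrable_const _)
      (fun s => ae_of_all _ fun ω => (norm_sub_le _ _).trans (add_le_add (hC _) (hC _))) ?_
    filter_upwards [ae_all_iff.2 fun s => hX.ae_eq_add_noiseSum 0 s,
      ae_all_iff.2 fun s => hX.ae_eq_add_noiseSum s h] with ω h1 h2
    have hz : Tendsto (fun s : ℕ => ρ ^ s * X 0 ω) atTop (𝓝 0) := by
      simpa using (tendsto_pow_atTop_nhds_zero_of_abs_lt_one hρ).mul_const (X 0 ω)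
    have hpair : Tendsto (fun s : ℕ => ((noiseSum ρ ε 0 s ω,
        ρ ^ h * noiseSum ρ ε 0 s ω + noiseSum ρ ε s h ω), (X s ω, X (s + h) ω))) atTop
        (uniformity (ℝ × ℝ)) := by
      rw [tendsto_uniformity_iff_dist_tendsto_zero]
      have hmax : Tendsto (fun s : ℕ => max |ρ ^ s * X 0 ω| |ρ ^ h * (ρ ^ s * X 0 ω)|) atTop
          (𝓝 0) := by
        simpa using hz.abs.max (hz.const_mul (ρ ^ h)).abs
      refine hmax.congr fun s => ?_
      have h1' := h1 s
      rw [zero_add] at h1'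
      rw [Prod.dist_eq, Real.dist_eq, Real.dist_eq, h2 s, h1']
      congr 1
      · rw [← abs_neg]; congr 1; ring
      · rw [← abs_neg]; congr 1; ring
    have := tendsto_uniformity_iff_dist_tendsto_zero.1 ((show Tendsto _ _ _ from hφ).comp hpair)
    rw [tendsto_zero_iff_norm_tendsto_zero]
    simpa [dist_eq_norm] using this
  have := hdiff.add_const (∫ ω, φ (X 0 ω, X h ω) ∂P)
  simp only [integral_zero, zero_add] at this
  refine this.congr fun s => ?_
  rw [integral_sub (hNi s) (hXi s), hst s, sub_add_cancel]

theorem uniformContinuous_exp_mul_I (a : ℝ) :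
    UniformContinuous (fun z : ℝ × ℝ => Complex.exp (a * z.1 * Complex.I)) := by
  have : LipschitzWith (Real.toNNReal |a|) (fun z : ℝ × ℝ => Complex.exp (a * z.1 * Complex.I)) := by
    refine LipschitzWith.of_dist_le_mul fun z w => ?_
    have e : Complex.exp (a * z.1 * Complex.I) - Complex.exp (a * w.1 * Complex.I)
        = Complex.exp ((a * w.1 : ℝ) * Complex.I) *
          (Complex.exp (Complex.I * ((a * (z.1 - w.1) : ℝ) : ℂ)) - 1) := by
      rw [mul_sub, ← Complex.exp_add]
      push_cast
      ring_nf
    rw [dist_eq_norm, e, norm_mul, Complex.norm_exp_ofReal_mul_I, one_mul,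
      Real.coe_toNNReal _ (abs_nonneg a)]
    refine (Real.norm_exp_I_mul_ofReal_sub_one_le).trans ?_
    rw [norm_mul, Real.norm_eq_abs]
    gcongr
    rw [← dist_eq_norm, Prod.dist_eq]
    exact le_max_left _ _
  exact this.uniformContinuous

/-- The characteristic functions of the noise sums converge to that of the standard normal, as their
variances `1 - ρ^{2s}` tend to `1`. By stationarity the limit is also that of `X 0`. -/
theorem IsStationaryAR1.map_eq_gaussianReal_zero (hX : IsStationaryAR1 P ρ X ε) (hρ : |ρ| < 1) :
    P.map (X 0) = gaussianReal 0 1 := by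
  have : IsProbabilityMeasure (P.map (X 0)) := Measure.isProbabilityMeasure_map (hX.aemeasurable 0)
  refine Measure.ext_of_charFun (funext fun a => ?_)
  have h1 := hX.tendsto_integral_noiseSum hρ (uniformContinuous_exp_mul_I a) (C := 1)
    (fun z => by
      rw [← Complex.ofReal_mul, Complex.norm_exp_ofReal_mul_I]) 0
  have h2 : charFun (P.map (X 0)) a = ∫ ω, Complex.exp (a * X 0 ω * Complex.I) ∂P := by
    rw [charFun_apply_real, integral_map (hX.aemeasurable 0) (by fun_prop)]
  rw [h2]
  refine tendsto_nhds_unique h1 ?_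
  have h3 : ∀ s : ℕ, ∫ ω, Complex.exp (a * noiseSum ρ ε 0 s ω * Complex.I) ∂P
      = charFun (gaussianReal 0 (Real.toNNReal (1 - ρ ^ (2 * s)))) a := by
    intro s
    rw [← hX.map_noiseSum hρ 0 s, charFun_apply_real,
      integral_map (hX.aemeasurable_noiseSum 0 s) (by fun_prop)]
  simp_rw [h3, charFun_gaussianReal]
  have hlim : Tendsto (fun s : ℕ => Real.toNNReal (1 - ρ ^ (2 * s))) atTop (𝓝 1) := by
    have hρ2 : |ρ ^ 2| < 1 := by rw [abs_pow]; exact pow_lt_one₀ (abs_nonneg _) hρ two_ne_zero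
    have := (tendsto_pow_atTop_nhds_zero_of_abs_lt_one hρ2).const_sub 1
    simp_rw [← pow_mul] at this
    simpa [Function.comp_def] using (continuous_real_toNNReal.tendsto _).comp this
  have hc : Continuous fun w : NNReal => Complex.exp (a * (0 : ℝ) * Complex.I - w * a ^ 2 / 2) := by
    have : Continuous fun w : NNReal => ((w : ℝ) : ℂ) := Complex.continuous_ofReal.comp NNReal.continuous_coe
    fun_prop
  exact (hc.tendsto 1).comp hlim

theorem IsStationaryAR1.map_eq_gaussianReal (hX : IsStationaryAR1 P ρ X ε) (hρ : |ρ| < 1) (t : ℕ) :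
    P.map (X t) = gaussianReal 0 1 := by
  have := ((hX.identDistrib_pair t 0).comp measurable_fst).map_eq
  rw [← hX.map_eq_gaussianReal_zero hρ]
  exact this

theorem uniformContinuous_exp_neg_quadratic {u v : ℝ} (hu : 0 < u) (hv : 0 < v) :
    UniformContinuous (fun z : ℝ × ℝ => Real.exp (-(u * z.1 ^ 2 + v * z.2 ^ 2))) := by
  refine Continuous.uniformContinuous_of_tendsto_cocompact (x := 0) (by fun_prop) ?_
  have hc : 0 < min u v := lt_min hu hv
  have h1 : Tendsto (fun z : ℝ × ℝ => Real.exp (-(min u v * ‖z‖ ^ 2))) (cocompact (ℝ × ℝ)) (𝓝 0) :=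
    Real.tendsto_exp_neg_atTop_nhds_zero.comp
      (((tendsto_pow_atTop two_ne_zero).comp tendsto_norm_cocompact_atTop).const_mul_atTop hc)
  refine squeeze_zero (fun z => (Real.exp_pos _).le) (fun z => Real.exp_le_exp.2 ?_) h1
  have h3 : min u v * z.1 ^ 2 ≤ u * z.1 ^ 2 := by gcongr; exact min_le_left _ _
  have h4 : min u v * z.2 ^ 2 ≤ v * z.2 ^ 2 := by gcongr; exact min_le_right _ _
  have h5 : 0 ≤ v * z.2 ^ 2 := by positivity
  have h6 : 0 ≤ u * z.1 ^ 2 := by positivity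
  rw [Prod.norm_def]
  rcases max_cases ‖z.1‖ ‖z.2‖ with h | h <;> rw [h.1, Real.norm_eq_abs, sq_abs] <;> linarith

/-- Only this transform of the pair is needed, not its full joint law. It is the limit as `ρ^{2s} →
0` of the transforms of independent noise sums. -/
theorem IsStationaryAR1.integral_exp_neg_quadratic (hX : IsStationaryAR1 P ρ X ε) (hρ : |ρ| < 1)
    (h : ℕ) {u v : ℝ} (hu : 0 < u) (hv : 0 < v) :
    ∫ ω, Real.exp (-(u * X 0 ω ^ 2 + v * X h ω ^ 2)) ∂P
      = (√((1 + 2 * u) * (1 + 2 * v) - 4 * u * v * (ρ ^ h) ^ 2))⁻¹ := by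
  have hρ2 : ρ ^ 2 < 1 := (sq_lt_one_iff_abs_lt_one ρ).2 hρ
  have h1 := hX.tendsto_integral_noiseSum hρ (uniformContinuous_exp_neg_quadratic hu hv) (C := 1)
    (fun z => by
      rw [Real.norm_of_nonneg (Real.exp_pos _).le, Real.exp_le_one_iff]
      have : 0 ≤ u * z.1 ^ 2 + v * z.2 ^ 2 := by positivity
      linarith) h
  refine tendsto_nhds_unique h1 ?_
  have h3 : ∀ s : ℕ, ∫ ω, Real.exp (-(u * noiseSum ρ ε 0 s ω ^ 2
        + v * (ρ ^ h * noiseSum ρ ε 0 s ω + noiseSum ρ ε s h ω) ^ 2)) ∂P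
      = (√((1 + 2 * u * (1 - (ρ ^ 2) ^ s)) * (1 + 2 * v * (1 - (ρ ^ 2) ^ h))
        + 2 * (1 - (ρ ^ 2) ^ s) * v * (ρ ^ h) ^ 2))⁻¹ := by
    intro s
    have hp : ∀ k : ℕ, 0 ≤ 1 - (ρ ^ 2) ^ k := fun k =>
      sub_nonneg.2 (pow_le_one₀ (sq_nonneg _) hρ2.le)
    have hmap := (hX.indepFun_noiseSum (s := 0) (h := s) (s' := s) (h' := h) (by omega)
      ).map_prod_eq_prod_map_map (hX.aemeasurable_noiseSum 0 s) (hX.aemeasurable_noiseSum s h)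
    rw [hX.map_noiseSum hρ, hX.map_noiseSum hρ] at hmap
    have hL := integral_exp_neg_quadratic_prod_gaussianReal hu.le hv.le (ρ ^ h)
      (Real.toNNReal (1 - ρ ^ (2 * s))) (Real.toNNReal (1 - ρ ^ (2 * h)))
    rw [← hmap, integral_map ((hX.aemeasurable_noiseSum 0 s).prodMk (hX.aemeasurable_noiseSum s h))
      (by fun_prop), pow_mul, pow_mul, Real.coe_toNNReal _ (hp s), Real.coe_toNNReal _ (hp h)] at hL
    exact hL
  simp_rw [h3]
  have hlim : Tendsto (fun s : ℕ => (ρ ^ 2) ^ s) atTop (𝓝 0) :=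
    tendsto_pow_atTop_nhds_zero_of_lt_one (sq_nonneg _) hρ2
  have hh : (ρ ^ h) ^ 2 ≤ 1 := by
    rw [← pow_mul, mul_comm, pow_mul]; exact pow_le_one₀ (sq_nonneg _) hρ2.le
  have hpos : 0 < (1 + 2 * u) * (1 + 2 * v) - 4 * u * v * (ρ ^ h) ^ 2 := by
    have : 4 * u * v * (ρ ^ h) ^ 2 ≤ 4 * u * v * 1 := by gcongr
    nlinarith
  have e : (1 + 2 * u * (1 - 0)) * (1 + 2 * v * (1 - (ρ ^ 2) ^ h)) + 2 * (1 - 0) * v * (ρ ^ h) ^ 2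
      = (1 + 2 * u) * (1 + 2 * v) - 4 * u * v * (ρ ^ h) ^ 2 := by
    rw [← pow_mul, ← pow_mul, mul_comm 2 h]; ring
  have hq : Continuous fun q : ℝ => (1 + 2 * u * (1 - q)) * (1 + 2 * v * (1 - (ρ ^ 2) ^ h))
      + 2 * (1 - q) * v * (ρ ^ h) ^ 2 := by fun_prop
  have hq' := (hq.tendsto 0).comp hlim
  rw [e] at hq'
  exact ((Real.continuous_sqrt.tendsto _).comp hq').inv₀ (Real.sqrt_pos.2 hpos).ne'

theorem IsStationaryAR1.hasSum_covariance_log_abs (hX : IsStationaryAR1 P ρ X ε) (hρ : |ρ| < 1)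
    (t h : ℕ) (hh : h ≠ 0) :
    HasSum (fun j : ℕ => arcsinSqCoeff j * (ρ ^ h) ^ (2 * (j + 1)))
      (covariance (fun ω => Real.log |X t ω|) (fun ω => Real.log |X (t + h) ω|) P) := by
  have hm := (hX.identDistrib_pair t h).aemeasurable_fst
  have hid := (hX.identDistrib_pair t h).map_eq
  have : IsProbabilityMeasure (P.map fun ω => (X t ω, X (t + h) ω)) :=
    Measure.isProbabilityMeasure_map hm
  have hm1 : Measurable fun x : ℝ × ℝ => Real.log |x.1| := measurable_log_abs.comp measurable_fst
  have hm2 : Measurable fun x : ℝ × ℝ => Real.log |x.2| := measurable_log_abs.comp measurable_snd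
  have := _root_.hasSum_covariance_log_abs (μ := P.map fun ω => (X t ω, X (t + h) ω)) (r := ρ ^ h)
    ?_ ?_ ?_ ?_
  · rwa [covariance_map hm1.aestronglyMeasurable hm2.aestronglyMeasurable hm] at this
  · rw [AEMeasurable.map_map_of_aemeasurable measurable_fst.aemeasurable hm]
    exact hX.map_eq_gaussianReal hρ t
  · rw [AEMeasurable.map_map_of_aemeasurable measurable_snd.aemeasurable hm]
    exact hX.map_eq_gaussianReal hρ (t + h)
  · rw [abs_pow]
    exact pow_lt_one₀ (abs_nonneg _) hρ hh
  · intro u v hu hv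
    rw [hid, integral_map (hX.identDistrib_pair t h).aemeasurable_snd (by fun_prop)]
    exact hX.integral_exp_neg_quadratic hρ h hu hv

theorem IsStationaryAR1.memLp_log_abs (hX : IsStationaryAR1 P ρ X ε) (hρ : |ρ| < 1) (t : ℕ) :
    MemLp (fun ω => Real.log |X t ω|) 2 P :=
  memLp_log_abs_of_map (hX.map_eq_gaussianReal hρ t)

theorem IsStationaryAR1.variance_log_abs (hX : IsStationaryAR1 P ρ X ε) (hρ : |ρ| < 1) (t : ℕ) :
    variance (fun ω => Real.log |X t ω|) P = Real.pi ^ 2 / 8 := by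
  rw [← variance_log_abs_gaussianReal, ← hX.map_eq_gaussianReal hρ t,
    variance_map measurable_log_abs.aemeasurable (hX.aemeasurable t)]
  rfl

end

/-! ### The coefficients `ν_{2k}`. -/

theorem contDiff_gaussianPDFReal : ContDiff ℝ ⊤ (gaussianPDFReal 0 1) := by
  have : gaussianPDFReal 0 1 = fun x : ℝ => (√(2 * Real.pi))⁻¹ * Real.exp (-(x ^ 2 / 2)) :=
    funext gaussianPDFReal_zero_one
  rw [this]
  fun_prop

theorem hasDerivAt_iteratedDeriv_gaussianPDFReal (n : ℕ) (x : ℝ) :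
    HasDerivAt (iteratedDeriv n (gaussianPDFReal 0 1))
      (iteratedDeriv (n + 1) (gaussianPDFReal 0 1) x) x := by
  rw [iteratedDeriv_succ]
  exact (contDiff_gaussianPDFReal.differentiable_iteratedDeriv n (by simp) x).hasDerivAt

/-- This is `f' = -x f` differentiated `n + 1` times. -/
theorem iteratedDeriv_add_two_gaussianPDFReal (n : ℕ) (x : ℝ) :
    iteratedDeriv (n + 2) (gaussianPDFReal 0 1) x
      = -(x * iteratedDeriv (n + 1) (gaussianPDFReal 0 1) x)
        - (n + 1) * iteratedDeriv n (gaussianPDFReal 0 1) x := by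
  induction n generalizing x with
  | zero =>
    have h1 : iteratedDeriv 1 (gaussianPDFReal 0 1) = fun x => -(x * gaussianPDFReal 0 1 x) := by
      ext x
      rw [iteratedDeriv_one]
      have : gaussianPDFReal 0 1 = fun x : ℝ => (√(2 * Real.pi))⁻¹ * Real.exp (-(x ^ 2 / 2)) :=
        funext gaussianPDFReal_zero_one
      rw [this]
      have h : HasDerivAt (fun x : ℝ => -(x ^ 2 / 2)) (-x) x := by
        convert! ((hasDerivAt_pow 2 x).div_const 2).neg using 1
        simp
      refine (h.exp.const_mul _).deriv.trans ?_
      ring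
    have h0 := hasDerivAt_iteratedDeriv_gaussianPDFReal 0 x
    have h2 := hasDerivAt_iteratedDeriv_gaussianPDFReal 1 x
    simp only [zero_add, iteratedDeriv_zero] at h0
    rw [h1] at h2
    rw [h2.unique ((hasDerivAt_id x).mul h0).neg, iteratedDeriv_zero]
    simp
    ring
  | succ n ih =>
    have h := hasDerivAt_iteratedDeriv_gaussianPDFReal (n + 2) x
    rw [show iteratedDeriv (n + 2) (gaussianPDFReal 0 1) = fun x =>
      -(x * iteratedDeriv (n + 1) (gaussianPDFReal 0 1) x)
        - (n + 1) * iteratedDeriv n (gaussianPDFReal 0 1) x from funext ih] at h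
    rw [h.unique ((((hasDerivAt_id x).mul (hasDerivAt_iteratedDeriv_gaussianPDFReal (n + 1) x)).neg).sub
      ((hasDerivAt_iteratedDeriv_gaussianPDFReal n x).const_mul ((n : ℝ) + 1)))]
    push_cast
    simp
    ring

/-- Serves integrability: polynomials and `log |x|` are both square-integrable for the Gaussian
measure. -/
theorem exists_polynomial_iteratedDeriv_gaussianPDFReal (n : ℕ) :
    ∃ p : Polynomial ℝ, ∀ x, iteratedDeriv n (gaussianPDFReal 0 1) x
      = p.eval x * gaussianPDFReal 0 1 x := by
  refine ⟨Polynomial.C ((-1) ^ n) * (Polynomial.hermite n).map (Int.castRingHom ℝ), fun x => ?_⟩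
  have : gaussianPDFReal 0 1 = fun x : ℝ => (√(2 * Real.pi))⁻¹ * Real.exp (-(x ^ 2 / 2)) :=
    funext gaussianPDFReal_zero_one
  rw [this, iteratedDeriv_const_mul_field, iteratedDeriv_eq_iterate,
    Polynomial.deriv_gaussian_eq_hermite_mul_gaussian, Polynomial.eval_mul, Polynomial.eval_C,
    Polynomial.eval_map, Polynomial.aeval_def, algebraMap_int_eq]
  ring

theorem integrable_mul_polynomial_mul_gaussianPDFReal {g : ℝ → ℝ} (hg : MemLp g 2 (gaussianReal 0 1))
    (p : Polynomial ℝ) : Integrable (fun x => g x * (p.eval x * gaussianPDFReal 0 1 x)) := by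
  have hp : MemLp (fun x => p.eval x) 2 (gaussianReal 0 1) := by
    induction p using Polynomial.induction_on' with
    | add p q hp hq => simpa using! hp.add hq
    | monomial n a =>
      simp only [Polynomial.eval_monomial]
      refine MemLp.const_mul ?_ a
      rw [memLp_two_iff_integrable_sq (by fun_prop)]
      simp_rw [← pow_mul]
      exact integrable_pow_of_mem_interior_integrableExpSet (X := id)
        (by rw [integrableExpSet_id_gaussianReal]; simp) (n * 2)
  have h := hg.integrable_mul hp
  rw [gaussianReal_of_var_ne_zero 0 one_ne_zero, gaussianPDF_def,
    integrable_withDensity_iff_integrable_smul₀' (by fun_prop) (by simp)] at h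
  refine h.congr (ae_of_all _ fun x => ?_)
  simp [gaussianPDFReal_nonneg]
  ring

theorem integrable_log_mul_iteratedDeriv (n : ℕ) :
    Integrable (fun x : ℝ => Real.log |x| * iteratedDeriv n (gaussianPDFReal 0 1) x) := by
  obtain ⟨p, hp⟩ := exists_polynomial_iteratedDeriv_gaussianPDFReal n
  simp_rw [hp]
  exact integrable_mul_polynomial_mul_gaussianPDFReal memLp_log_abs_gaussianReal p

theorem integrable_log_mul_mul_iteratedDeriv (n : ℕ) :
    Integrable (fun x : ℝ => Real.log |x| * (x * iteratedDeriv n (gaussianPDFReal 0 1) x)) := by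
  obtain ⟨p, hp⟩ := exists_polynomial_iteratedDeriv_gaussianPDFReal n
  refine (integrable_mul_polynomial_mul_gaussianPDFReal memLp_log_abs_gaussianReal
    (Polynomial.X * p)).congr (ae_of_all _ fun x => ?_)
  simp [hp, mul_assoc]

theorem integrable_iteratedDeriv_gaussianPDFReal (n : ℕ) :
    Integrable (iteratedDeriv n (gaussianPDFReal 0 1)) := by
  obtain ⟨p, hp⟩ := exists_polynomial_iteratedDeriv_gaussianPDFReal n
  refine (integrable_mul_polynomial_mul_gaussianPDFReal (memLp_const 1) p).congr
    (ae_of_all _ fun x => ?_)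
  simp [hp]

theorem integral_iteratedDeriv_succ_gaussianPDFReal (n : ℕ) :
    ∫ x, iteratedDeriv (n + 1) (gaussianPDFReal 0 1) x = 0 :=
  integral_eq_zero_of_hasDerivAt_of_integrable (hasDerivAt_iteratedDeriv_gaussianPDFReal n)
    (integrable_iteratedDeriv_gaussianPDFReal _) (integrable_iteratedDeriv_gaussianPDFReal _)

/-- Meant for `x log |x| f^{(n)}(x)`, which is continuous at `0` but need not be differentiable
there. -/
theorem integral_eq_zero_of_hasDerivAt_off_zero {F F' : ℝ → ℝ} (hc : ContinuousAt F 0)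
    (hd : ∀ x, x ≠ 0 → HasDerivAt F (F' x) x) (hi : Integrable F) (hi' : Integrable F') :
    ∫ x, F' x = 0 := by
  have ht := tendsto_zero_of_hasDerivAt_of_integrableOn_Ioi (a := 0)
    (fun x (hx : 0 < x) => hd x hx.ne') hi'.integrableOn hi.integrableOn
  -- The closed half-line must avoid `0`; any negative endpoint gives the limit at `-∞`.
  have hb := tendsto_zero_of_hasDerivAt_of_integrableOn_Iic (a := -1)
    (fun x (hx : x ≤ -1) => hd x (by linarith)) hi'.integrableOn hi.integrableOn
  rw [← intervalIntegral.integral_Iic_add_Ioi (b := 0) hi'.integrableOn hi'.integrableOn,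
    integral_Ioi_of_hasDerivAt_of_tendsto hc.continuousWithinAt
      (fun x (hx : 0 < x) => hd x hx.ne') hi'.integrableOn ht,
    integral_Iic_of_hasDerivAt_of_tendsto hc.continuousWithinAt
      (fun x (hx : x < 0) => hd x hx.ne) hi'.integrableOn hb]
  ring

/-- The derivative of `x log |x| f^{(n)}` has integral zero; the Hermite recursion then eliminates
`x f^{(n+1)}`. -/
theorem integral_log_mul_iteratedDeriv_add_two (n : ℕ) :
    ∫ x : ℝ, Real.log |x| * iteratedDeriv (n + 2) (gaussianPDFReal 0 1) x
      = (∫ x, iteratedDeriv n (gaussianPDFReal 0 1) x)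
        - n * ∫ x : ℝ, Real.log |x| * iteratedDeriv n (gaussianPDFReal 0 1) x := by
  have i0 := integrable_log_mul_iteratedDeriv n
  have i1 := integrable_log_mul_mul_iteratedDeriv (n + 1)
  have i2 := integrable_iteratedDeriv_gaussianPDFReal n
  have hparts : ∫ x : ℝ, (Real.log |x| * iteratedDeriv n (gaussianPDFReal 0 1) x
      + iteratedDeriv n (gaussianPDFReal 0 1) x
      + Real.log |x| * (x * iteratedDeriv (n + 1) (gaussianPDFReal 0 1) x)) = 0 := by
    refine integral_eq_zero_of_hasDerivAt_off_zero
      (F := fun x => Real.log |x| * (x * iteratedDeriv n (gaussianPDFReal 0 1) x)) ?_ ?_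
      (integrable_log_mul_mul_iteratedDeriv n) ((i0.add i2).add i1)
    · have h1 : ContinuousAt (fun x => x * Real.log x) 0 := Real.continuous_mul_log.continuousAt
      refine (h1.mul (hasDerivAt_iteratedDeriv_gaussianPDFReal n 0).continuousAt).congr
        (Eventually.of_forall fun x => ?_)
      simp only [Real.log_abs, Pi.mul_apply]
      ring
    · intro x hx
      simp only [Real.log_abs]
      convert! (Real.hasDerivAt_log hx).mul
        ((hasDerivAt_id x).mul (hasDerivAt_iteratedDeriv_gaussianPDFReal n x)) using 1
      simp
      field_simp
      ring
  rw [integral_add ?_ i1, integral_add i0 i2] at hparts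
  swap
  · exact i0.add i2
  have he : ∀ x : ℝ, Real.log |x| * iteratedDeriv (n + 2) (gaussianPDFReal 0 1) x
      = -(Real.log |x| * (x * iteratedDeriv (n + 1) (gaussianPDFReal 0 1) x))
        - (n + 1) * (Real.log |x| * iteratedDeriv n (gaussianPDFReal 0 1) x) := by
    intro x
    rw [iteratedDeriv_add_two_gaussianPDFReal]
    ring
  simp_rw [he]
  rw [integral_sub ?_ (i0.const_mul _), integral_neg, integral_const_mul]
  swap
  · exact i1.neg
  linarith

theorem logCoeff_succ (j : ℕ) : logCoeff (j + 1) = 2 ^ j * (j.factorial : ℝ) := by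
  have key : ∫ x : ℝ, Real.log |x| * iteratedDeriv (2 * (j + 1)) (gaussianPDFReal 0 1) x
      = (-1) ^ j * (2 ^ j * (j.factorial : ℝ)) := by
    -- The base case uses `∫ f = 1`. Afterwards derivatives integrate to zero, so each step
    -- multiplies by `-2(j+1)`.
    induction j with
    | zero =>
      have := integral_log_mul_iteratedDeriv_add_two 0
      simp only [iteratedDeriv_zero, integral_gaussianPDFReal_eq_one 0 one_ne_zero] at this
      simpa using this
    | succ j ih =>
      rw [show 2 * (j + 1 + 1) = 2 * (j + 1) + 2 by ring, integral_log_mul_iteratedDeriv_add_two, ih,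
        show 2 * (j + 1) = (2 * j + 1) + 1 by ring, integral_iteratedDeriv_succ_gaussianPDFReal,
        Nat.factorial_succ]
      push_cast
      ring
  rw [logCoeff, key, ← mul_assoc, ← pow_add, show j + 1 + 1 + j = 2 * (j + 1) by ring, pow_mul]
  simp

/-! ### The Lambert series. -/

theorem lambertTerm_succ (ρ : ℝ) (j : ℕ) : lambertTerm ρ (j + 1)
    = arcsinSqCoeff j * (ρ ^ (2 * (j + 1)) / (1 - ρ ^ (2 * (j + 1)))) := by
  rw [lambertTerm, logCoeff_succ, arcsinSqCoeff]

theorem summable_lambertTerm {ρ : ℝ} (hρ : |ρ| < 1) :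
    Summable fun j : ℕ => lambertTerm ρ (j + 1) := by
  have hr2 : ρ ^ 2 < 1 := (sq_lt_one_iff_abs_lt_one ρ).2 hρ
  have hq : ∀ j : ℕ, (ρ ^ 2) ^ (j + 1) ≤ ρ ^ 2 := fun j =>
    pow_le_of_le_one (sq_nonneg ρ) hr2.le (by omega)
  refine Summable.of_nonneg_of_le (fun j => ?_) (fun j => ?_)
    (((summable_nat_add_iff 1).2 (summable_geometric_of_lt_one (sq_nonneg ρ) hr2)).mul_right
      (1 - ρ ^ 2)⁻¹)
  · rw [lambertTerm_succ, pow_mul]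
    exact mul_nonneg (arcsinSqCoeff_nonneg j) (div_nonneg (by positivity) (by linarith [hq j]))
  · rw [lambertTerm_succ, pow_mul, div_eq_mul_inv]
    have h1 : (1 - (ρ ^ 2) ^ (j + 1))⁻¹ ≤ (1 - ρ ^ 2)⁻¹ :=
      inv_anti₀ (by linarith) (by linarith [hq j])
    have h2 : 0 ≤ (1 - (ρ ^ 2) ^ (j + 1))⁻¹ := inv_nonneg.2 (by linarith [hq j])
    exact (mul_le_of_le_one_left (by positivity) (arcsinSqCoeff_le_one j)).trans
      (mul_le_mul_of_nonneg_left h1 (by positivity))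

/-- For fixed `j` the sum over lags is geometric. Only even powers of `ρ` occur, so the double
series is nonnegative and may be summed in either order. -/
theorem hasSum_tsum_arcsinSqCoeff {ρ : ℝ} (hρ : |ρ| < 1) :
    HasSum (fun h : ℕ => ∑' j : ℕ, arcsinSqCoeff j * (ρ ^ (h + 1)) ^ (2 * (j + 1)))
      (∑' j : ℕ, lambertTerm ρ (j + 1)) := by
  have hr2 : ρ ^ 2 < 1 := (sq_lt_one_iff_abs_lt_one ρ).2 hρ
  have hrow : ∀ j : ℕ, HasSum (fun h : ℕ => arcsinSqCoeff j * (ρ ^ (h + 1)) ^ (2 * (j + 1)))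
      (lambertTerm ρ (j + 1)) := by
    intro j
    have hq0 : 0 ≤ ρ ^ (2 * (j + 1)) := by rw [pow_mul]; positivity
    have hq1 : ρ ^ (2 * (j + 1)) < 1 := by
      rw [pow_mul]; exact pow_lt_one₀ (sq_nonneg ρ) hr2 (by omega)
    have h1 := ((hasSum_geometric_of_lt_one hq0 hq1).mul_left (ρ ^ (2 * (j + 1)))).mul_left
      (arcsinSqCoeff j)
    rw [← div_eq_mul_inv, ← lambertTerm_succ] at h1
    refine h1.congr_fun fun h => ?_
    rw [← pow_succ', ← pow_mul, ← pow_mul, mul_comm (h + 1)]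
  have hsum : Summable fun p : ℕ × ℕ => arcsinSqCoeff p.1 * (ρ ^ (p.2 + 1)) ^ (2 * (p.1 + 1)) := by
    rw [summable_prod_of_nonneg fun p => ?_]
    · refine ⟨fun j => (hrow j).summable, ?_⟩
      simp_rw [fun j => (hrow j).tsum_eq]
      exact summable_lambertTerm hρ
    · rw [pow_mul (ρ ^ (p.2 + 1))]
      exact mul_nonneg (arcsinSqCoeff_nonneg _) (by positivity)
  have hS := hsum.hasSum
  rw [(hS.prod_fiberwise hrow).tsum_eq]
  have hswap := (Equiv.prodComm ℕ ℕ).hasSum_iff.2 hS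
  exact hswap.prod_fiberwise fun h => (hsum.prod_symm.prod_factor h).hasSum

/-! ### Variance of the partial sums and its limit. -/

section
variable {Ω : Type*} [MeasurableSpace Ω] {P : Measure Ω} [IsProbabilityMeasure P]
  {ρ : ℝ} {X ε : ℕ → Ω → ℝ}

/-- Adjoining one more observation adds its variance and twice its covariances with the earlier
ones. The increments are thus partial sums of the limiting series, and division by `n` gives their
Cesàro mean. -/
theorem IsStationaryAR1.variance_sum_log_abs (hX : IsStationaryAR1 P ρ X ε) (hρ : |ρ| < 1) (n : ℕ) :
    variance (fun ω => ∑ t ∈ Finset.Icc 1 n, Real.log |X t ω|) P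
      = ∑ m ∈ Finset.range n, (Real.pi ^ 2 / 8 + 2 * ∑ h ∈ Finset.range m,
          ∑' j : ℕ, arcsinSqCoeff j * (ρ ^ (h + 1)) ^ (2 * (j + 1))) := by
  have hL := hX.memLp_log_abs hρ
  induction n with
  | zero =>
    simp only [Finset.range_zero, Finset.sum_empty, zero_lt_one, Finset.Icc_eq_empty_of_lt]
    exact variance_zero P
  | succ n ih =>
    have e : (fun ω => ∑ t ∈ Finset.Icc 1 (n + 1), Real.log |X t ω|)
        = (fun ω => ∑ t ∈ Finset.Icc 1 n, Real.log |X t ω|) + fun ω => Real.log |X (n + 1) ω| := by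
      ext ω
      rw [Finset.sum_Icc_succ_top (by omega), Pi.add_apply]
    rw [e, variance_add (memLp_finsetSum _ fun t _ => hL t) (hL (n + 1)), ih,
      hX.variance_log_abs hρ, covariance_fun_sum_left' (fun t _ => hL t) (hL (n + 1)),
      Finset.sum_range_succ]
    have hc : ∑ t ∈ Finset.Icc 1 n,
        covariance (fun ω => Real.log |X t ω|) (fun ω => Real.log |X (n + 1) ω|) P
        = ∑ h ∈ Finset.range n, ∑' j : ℕ, arcsinSqCoeff j * (ρ ^ (h + 1)) ^ (2 * (j + 1)) := by
      -- The index `h = n - t` stands for the lag `h + 1` between `t` and `n + 1`.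
      refine Finset.sum_bij' (fun t _ => n - t) (fun h _ => n - h) ?_ ?_ ?_ ?_ ?_
      · intro t ht; simp only [Finset.mem_Icc, Finset.mem_range] at *; omega
      · intro t ht; simp only [Finset.mem_Icc, Finset.mem_range] at *; omega
      · intro t ht; simp only [Finset.mem_Icc] at *; omega
      · intro t ht; simp only [Finset.mem_range] at *; omega
      · intro t ht
        have ht' := Finset.mem_Icc.1 ht
        have := (hX.hasSum_covariance_log_abs hρ t (n - t + 1) (by omega)).tsum_eq
        rw [this, show t + (n - t + 1) = n + 1 by omega]
    rw [hc]
    ring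

theorem IsStationaryAR1.tendsto_variance_log_abs (hX : IsStationaryAR1 P ρ X ε) (hρ : |ρ| < 1) :
    Tendsto (fun n : ℕ =>
        variance (fun ω => (√(n : ℝ))⁻¹ * ∑ t ∈ Finset.Icc 1 n, Real.log |X t ω|) P)
      atTop (𝓝 (Real.pi ^ 2 / 8 + 2 * ∑' k : ℕ, lambertTerm ρ (k + 1))) := by
  refine (((hasSum_tsum_arcsinSqCoeff hρ).tendsto_sum_nat.const_mul 2).const_add
    (Real.pi ^ 2 / 8)).cesaro.congr fun n => ?_
  rw [variance_const_mul, inv_pow, Real.sq_sqrt n.cast_nonneg, hX.variance_sum_log_abs hρ]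

end

theorem mainTheorem1 {Ω : Type*} [MeasurableSpace Ω] (P : Measure Ω) [IsProbabilityMeasure P]
    (ρ : ℝ) (hρ : |ρ| < 1) (X ε : ℕ → Ω → ℝ) (hX : IsStationaryAR1 P ρ X ε) :
    (∀ k : ℕ, 1 ≤ k →
      Integrable (fun x : ℝ => Real.log |x| * iteratedDeriv (2 * k) (gaussianPDFReal 0 1) x) ∧
      logCoeff k = 2 ^ (k - 1) * ((k - 1).factorial : ℝ)) ∧
    (∀ t : ℕ, MemLp (fun ω => Real.log |X t ω|) 2 P ∧
      variance (fun ω => Real.log |X t ω|) P = Real.pi ^ 2 / 8) ∧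
    Summable (fun k : ℕ => lambertTerm ρ (k + 1)) ∧
    Tendsto
      (fun n : ℕ =>
        variance (fun ω => (√(n : ℝ))⁻¹ * ∑ t ∈ Finset.Icc 1 n, Real.log |X t ω|) P)
      atTop (𝓝 (Real.pi ^ 2 / 8 + 2 * ∑' k : ℕ, lambertTerm ρ (k + 1))) := by
  refine ⟨fun k hk => ⟨integrable_log_mul_iteratedDeriv _, ?_⟩,
    fun t => ⟨hX.memLp_log_abs hρ t, hX.variance_log_abs hρ t⟩,
    summable_lambertTerm hρ, hX.tendsto_variance_log_abs hρ⟩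
  obtain ⟨j, rfl⟩ := Nat.exists_eq_add_of_le' hk
  rw [logCoeff_succ, Nat.add_sub_cancel]
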